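/- **Theorem (a combinatorial number of minimizers).** Let $N\ge 2$ be even, $M\in\mathbb N$, $\sigma\ge 0$, $\mathcal N=\{-N/2,\dots,N/2-1\}$ and $u\in\mathbb C^{\mathcal N}$. For $\xi\in\mathbb R$ let $\hat u(\xi)=\frac1{\sqrt N}\sum_{n\in\mathcal N}u_n e^{-2\pi\mathrm i\,\xi n/N}$. For $\Xi=(\xi_1,\dots,\xi_M)\in\mathbb R^M$ let $A(\Xi)\in\mathbb C^{\mathcal N\times M}$ be the matrix with entries $A(\Xi)_{n,m}=\frac1{\sqrt N}e^{2\pi\mathrm i\,\xi_m n/N}$. Consider the three reconstruction matrices - (back-projection) $R_1(\Xi)=A(\Xi)$, - (pseudo-inverse) $R_2(\Xi)=(A(\Xi)^*)^+$, the Moore–Penrose pseudo-inverse of $A(\Xi)^*$, - (Tikhonov, with parameter $\lambda>0$) $R_3(\Xi)=(1+\lambda)\,(A(\Xi)A(\Xi)^*+\lambda\,\mathrm{Id})^{-1}A(\Xi)$, and the costs $$J_i(\Xi)=\mathbb E_w\Big(\tfrac12\big\|R_i(\Xi)(A(\Xi)^*u+w)-u\big\|_2^2\Big),$$ where $w$ is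 white circular complex Gaussian noise in $\mathbb C^M$ with covariance $\sigma^2\mathrm{Id}$ (so $\mathbb E|w_m|^2=\sigma^2$). For $0<\epsilon<1$ set $$a_1=0,\quad a_2=a_3=\frac{\epsilon}{1-\epsilon},\qquad b_1=\epsilon,\quad b_2=\frac{\epsilon}{1-\epsilon},\quad b_3=\frac{4\epsilon}{(1-\epsilon)^2}.$$ Let $\mathrm{dist}(x,y)=\inf_{k\in\mathbb Z}|x-y-kN|$ be the distance on the torus $\mathbb R/N\mathbb Z$. Fix $i\in\{1,2,3\}$, let $r>0$, $c>0$, $\delta>1+2r$, and let $Z\subset\mathbb R$ be a set of $K\ge M$ points such that 1. every $\zeta\in Z$ is a local maximizer of $|\hat u|^2$, and $\mathrm{dist}(\zeta,\zeta')\ge\delta$ for all distinct $\zeta,\zeta'\in Z$; 2. $|\hat u(\zeta+h)|^2\le|\hat u(\zeta)|^2-c\,h^2$ for all $\zeta\in Z$ and all $h\in[-r,r]$; 3. for every subset $\bar\Xi\subset Z$ with $M$ elements, $$\frac{c\,r^2}{2}>(b_i+2a_i)\sum_{\zeta\in\bar\Xi}|\hat u(\zeta)|^2+b_i\,M\,\sigma^2,$$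 where $a_i,b_i$ are taken at $\epsilon=\frac1{\delta-2r}$. Then for every $M$-tuple $(\bar\xi_1,\dots,\bar\xi_M)$ of distinct points of $Z$, the function $J_i:\mathbb R^M\to\mathbb R$ has a local minimizer in the open box $\prod_{m=1}^M(\bar\xi_m-r,\bar\xi_m+r)$. Moreover, $J_i$ has at least $\binom KM\,M!$ local minimizers in $[-N/2,N/2)^M$, that is, up to $N$-periodicity in each variable. -/

import Mathlib

open MeasureTheory ProbabilityTheory Matrix

open scoped NNReal Nat

noncomputable section

namespace FourierSampling

/-- The index set `{-N/2, …, N/2 - 1}` of a signal of even length `N`. -/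
abbrev Grid (N : ℕ) : Type := {n : ℤ // n ∈ Finset.Ico (-((N : ℤ) / 2)) ((N : ℤ) / 2)}

/-- The Fourier transform of the signal `u` at the real frequency `ξ`. -/
def uhat {N : ℕ} (u : Grid N → ℂ) (ξ : ℝ) : ℂ :=
  (1 / (Real.sqrt N : ℂ)) *
    ∑ n : Grid N, u n * Complex.exp (-(2 * Complex.I * Real.pi * (ξ * ((n.1 : ℂ) / (N : ℂ)))))

/-- The normalized Vandermonde matrix `A(Ξ)`. -/
def vander (N : ℕ) {M : ℕ} (Ξ : Fin M → ℝ) : Matrix (Grid N) (Fin M) ℂ :=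
  Matrix.of fun n m =>
    (1 / (Real.sqrt N : ℂ)) *
      Complex.exp (2 * Complex.I * Real.pi * (Ξ m * ((n.1 : ℂ) / (N : ℂ))))

/-- The distance on the torus `ℝ / N ℤ`. -/
def torusDist (N : ℕ) (x y : ℝ) : ℝ := ⨅ k : ℤ, |x - y - (k : ℝ) * (N : ℝ)|

section PseudoInverse

open scoped ComplexOrder

variable {m n : Type*} [Fintype m] [Fintype n] [DecidableEq n]

/-- The Moore–Penrose conditions. -/
structure IsMoorePenrose (B : Matrix m n ℂ) (X : Matrix n m ℂ) : Prop where
  mul_mul_self : B * X * B = B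
  mul_mul_inv : X * B * X = X
  hermitian_left : (B * X)ᴴ = B * X
  hermitian_right : (X * B)ᴴ = X * B

/-- The Moore–Penrose pseudo-inverse `B⁺ = (Bᴴ B)⁺ Bᴴ`, where the pseudo-inverse of the Hermitian
matrix `Bᴴ B` inverts its nonzero eigenvalues (and `0⁻¹ = 0`). -/
def pinv (B : Matrix m n ℂ) : Matrix n m ℂ :=
  let h := Matrix.isHermitian_conjTranspose_mul_self B
  (h.eigenvectorUnitary : Matrix n n ℂ) *
    Matrix.diagonal (fun i => (((h.eigenvalues i)⁻¹ : ℝ) : ℂ)) *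
    (h.eigenvectorUnitary : Matrix n n ℂ)ᴴ * Bᴴ

theorem pinv_isMoorePenrose (B : Matrix m n ℂ) : IsMoorePenrose B (pinv B) := by
  have h := Matrix.isHermitian_conjTranspose_mul_self B
  set U : Matrix n n ℂ := (h.eigenvectorUnitary : Matrix n n ℂ) with hU
  set D : Matrix n n ℂ := Matrix.diagonal (fun i => ((h.eigenvalues i : ℝ) : ℂ)) with hD
  set E : Matrix n n ℂ := Matrix.diagonal (fun i => (((h.eigenvalues i)⁻¹ : ℝ) : ℂ)) with hE
  have hp : pinv B = U * E * Uᴴ * Bᴴ := rfl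
  have hUU : Uᴴ * U = 1 := Unitary.coe_star_mul_self h.eigenvectorUnitary
  have hH : Bᴴ * B = U * D * Uᴴ := by
    have := h.spectral_theorem
    rw [Unitary.conjStarAlgAut_apply] at this
    exact this
  have hEh : Eᴴ = E := by
    rw [hE, Matrix.diagonal_conjTranspose]
    congr 1
    funext i
    simp
  have hDh : Dᴴ = D := by
    rw [hD, Matrix.diagonal_conjTranspose]
    congr 1
    funext i
    simp
  have hED : E * D = D * E := by
    rw [hE, hD, Matrix.diagonal_mul_diagonal, Matrix.diagonal_mul_diagonal]
    congr 1
    funext i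
    ring
  have hDED : D * E * D = D := by
    rw [hE, hD, Matrix.diagonal_mul_diagonal, Matrix.diagonal_mul_diagonal]
    congr 1
    funext i
    by_cases h0 : h.eigenvalues i = 0
    · simp [h0]
    · have : ((h.eigenvalues i : ℝ) : ℂ) ≠ 0 := by exact_mod_cast h0
      push_cast
      field_simp
  have hEDE : E * D * E = E := by
    rw [hE, hD, Matrix.diagonal_mul_diagonal, Matrix.diagonal_mul_diagonal]
    congr 1
    funext i
    by_cases h0 : h.eigenvalues i = 0
    · simp [h0]
    · have : ((h.eigenvalues i : ℝ) : ℂ) ≠ 0 := by exact_mod_cast h0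
      push_cast
      field_simp
  have key : ∀ X Y : Matrix n n ℂ, (U * X * Uᴴ) * (U * Y * Uᴴ) = U * (X * Y) * Uᴴ := by
    intro X Y
    calc (U * X * Uᴴ) * (U * Y * Uᴴ) = U * X * (Uᴴ * U) * Y * Uᴴ := by
          simp only [Matrix.mul_assoc]
      _ = U * (X * Y) * Uᴴ := by rw [hUU]; simp only [Matrix.mul_assoc, Matrix.mul_one]
  have hXB : pinv B * B = U * (E * D) * Uᴴ := by
    rw [hp, Matrix.mul_assoc, hH, key]
  have hP : (U * (E * D) * Uᴴ)ᴴ = U * (E * D) * Uᴴ := by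
    simp only [Matrix.conjTranspose_mul, Matrix.conjTranspose_conjTranspose, hEh, hDh,
      Matrix.mul_assoc]
    rw [← Matrix.mul_assoc D E, ← hED, Matrix.mul_assoc]
  refine ⟨?_, ?_, ?_, ?_⟩
  · rw [Matrix.mul_assoc, hXB]
    have hz : (B * (U * (E * D) * Uᴴ) - B)ᴴ * (B * (U * (E * D) * Uᴴ) - B) = 0 := by
      rw [Matrix.conjTranspose_sub, Matrix.conjTranspose_mul, hP]
      simp only [Matrix.sub_mul, Matrix.mul_sub]
      have e1 : U * (E * D) * Uᴴ * Bᴴ * B = Bᴴ * B := by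
        rw [Matrix.mul_assoc _ Bᴴ B, hH, key, hED, hDED]
      have e2 : Bᴴ * (B * (U * (E * D) * Uᴴ)) = Bᴴ * B := by
        rw [← Matrix.mul_assoc, hH, key, ← Matrix.mul_assoc D E D, hDED]
      have e3 : U * (E * D) * Uᴴ * Bᴴ * (B * (U * (E * D) * Uᴴ)) = Bᴴ * B := by
        rw [Matrix.mul_assoc _ Bᴴ, e2, ← Matrix.mul_assoc, e1]
      rw [e1, e2, e3]
      simp
    exact sub_eq_zero.mp (Matrix.conjTranspose_mul_self_eq_zero.mp hz)
  · rw [hXB, hp, ← Matrix.mul_assoc, key, hEDE]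
  · rw [hp]
    simp only [Matrix.conjTranspose_mul, Matrix.conjTranspose_conjTranspose, hEh,
      Matrix.mul_assoc]
  · rw [hXB, hP]

end PseudoInverse

/-- The three linear reconstruction methods; the Tikhonov one has a parameter `lam > 0`. -/
inductive Method : Type
  | backProjection : Method
  | pseudoInverse : Method
  | tikhonov (lam : ℝ) (hlam : 0 < lam) : Method

/-- The reconstruction matrix `R(Ξ)` of each method. -/
def Method.recon (N : ℕ) {M : ℕ} (Ξ : Fin M → ℝ) : Method → Matrix (Grid N) (Fin M) ℂ
  | .backProjection => vander N Ξ
  | .pseudoInverse => pinv (vander N Ξ)ᴴ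
  | .tikhonov lam _ =>
      ((1 + lam : ℝ) : ℂ) •
        ((vander N Ξ * (vander N Ξ)ᴴ + ((lam : ℝ) : ℂ) • (1 : Matrix (Grid N) (Grid N) ℂ))⁻¹ *
          vander N Ξ)

/-- The constant `a` of each method as a function of `ε`. -/
def Method.aConst : Method → ℝ → ℝ
  | .backProjection, _ => 0
  | .pseudoInverse, ε => ε / (1 - ε)
  | .tikhonov _ _, ε => ε / (1 - ε)

/-- The constant `b` of each method as a function of `ε`. -/
def Method.bConst : Method → ℝ → ℝ
  | .backProjection, ε => ε
  | .pseudoInverse, ε => ε / (1 - ε)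
  | .tikhonov _ _, ε => 4 * ε / (1 - ε) ^ 2

/-- The centred circular complex Gaussian law with `E |z|² = σ²`: independent real and imaginary
parts of variance `σ² / 2`. -/
def complexGaussian (σ : ℝ) : Measure ℂ :=
  ((gaussianReal 0 (Real.toNNReal (σ ^ 2 / 2))).prod
    (gaussianReal 0 (Real.toNNReal (σ ^ 2 / 2)))).map Complex.measurableEquivRealProd.symm

/-- The law of white Gaussian noise in `ℂ^M` with covariance `σ² Id`. -/
def whiteNoise (M : ℕ) (σ : ℝ) : Measure (Fin M → ℂ) :=
  Measure.pi fun _ => complexGaussian σ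

/-- The cost `J(Ξ) = E_w (½ ‖R(Ξ) (A(Ξ)ᴴ u + w) - u‖²)`. -/
def cost {N M : ℕ} (i : Method) (σ : ℝ) (u : Grid N → ℂ) (Ξ : Fin M → ℝ) : ℝ :=
  ∫ w : Fin M → ℂ,
    (1 / 2 : ℝ) *
      ‖WithLp.toLp 2 (i.recon N Ξ *ᵥ ((vander N Ξ)ᴴ *ᵥ u + w) - u)‖ ^ 2 ∂(whiteNoise M σ)

end FourierSampling

end

/-!
The expected cost depends on the frequencies `Ξ` almost separably: up to an additive constant it is
`-½ ∑ₘ |û(ξₘ)|²`, with an error controlled by how far the columns of `A(Ξ)` are from orthonormal.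

*Large sieve.* Let `G = A(Ξ)ᴴ A(Ξ)`. For frequencies that are `D`-separated on the torus,
`|xᴴ (G - 1) x| ≤ ‖x‖² / D` (`norm_gram_sub_le`). Off the diagonal `G` is a Dirichlet kernel, which
splits into two unitarily twisted copies of the matrix `1 / sin (θ_r - θ_s)`; each is controlled by
the Hilbert inequality of Montgomery and Vaughan (`norm_star_dotProduct_cscMatrix_le`). That
inequality is proved on eigenvectors: `csc a csc b = csc (a - b) (cot b - cot a)` turns `HᴴH` into a
commutator, whose quadratic form vanishes on eigenvectors, plus a remainder bounded by
`∑ₛ (1 + 2|cos|) / sin²`. Since `(1 + 2 cos x) / sin² x ≤ 3 / x²`, the Basel sum gives exactly the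
constant `1 / D`.

*Cost.* The noise has mean zero and covariance `σ² Id`, so the cost is half of the sum of the
squared bias and `σ²` times the squared Frobenius norm of the reconstruction matrix (`cost_eq`). If
`G` is invertible, all three reconstruction matrices have the form `A f(G)`, with `f x = 1`, `x⁻¹`
and `(1 + λ) / (x + λ)` respectively (`recon_eq_mul_spectralMap`).
In an eigenbasis of `G` the cost is therefore governed by the scalars `f(g)² g - 2 f(g)` and
`f(g)² g`, which are `-1` and `1` at `g = 1` and within `b` of these values when `|g - 1| ≤ ε`
(`abs_weight_sub_le`). This gives `abs_cost_sub_le`.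

*Minimizers.* In the closed box of radius `r` around a tuple of points of `Z`, frequencies stay
`(δ - 2r)`-separated. On the boundary of the box the separable part has risen by at least
`c r² / 2`, which beats the two error terms, so the minimum over the box is attained inside it
(`exists_isLocalMin_cost_of_box`). Distinct tuples have boxes that are disjoint modulo `N`, and the
cost is `N`-periodic in each variable, so the embeddings of `Fin M` into `Z` are counted by distinct
local minimizers in `[-N/2, N/2)^M`.
-/

namespace FourierSampling

/-! ### Lattice sums for separated points of the circle -/

/-- Both sides agree with `3 x² - x⁴ + x⁶ / 12` once `sin x` and `cos x` are replaced by the Taylor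
bounds `sin x ≥ x - x³ / 6` and `cos x ≤ 1 - x² / 2 + x⁴ / 24`. -/
theorem sq_mul_one_add_two_cos_le {x : ℝ} (h0 : 0 ≤ x) (h1 : x ≤ 2) :
    x ^ 2 * (1 + 2 * Real.cos x) ≤ 3 * Real.sin x ^ 2 := by
  have hsin : (x - x ^ 3 / 6) ^ 2 ≤ Real.sin x ^ 2 := by
    apply pow_le_pow_left₀ _ (Real.sin_ge_sub_cube h0)
    nlinarith [mul_nonneg h0 (by nlinarith : 0 ≤ 4 - x ^ 2)]
  have hhalf : (x / 2 - (x / 2) ^ 3 / 6) ^ 2 ≤ Real.sin (x / 2) ^ 2 := by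
    apply pow_le_pow_left₀ _ (Real.sin_ge_sub_cube (by linarith))
    nlinarith [mul_nonneg h0 (by nlinarith : 0 ≤ 4 - x ^ 2)]
  have hcos : Real.cos x ≤ 1 - x ^ 2 / 2 + x ^ 4 / 24 := by
    have h := Real.cos_sq' (x / 2)
    have h' := Real.cos_sq (x / 2)
    rw [show 2 * (x / 2) = x by ring] at h'
    nlinarith [sq_nonneg (x ^ 3)]
  nlinarith [mul_le_mul_of_nonneg_left hcos (sq_nonneg x)]

theorem one_add_two_abs_cos_div_sin_sq_le {x : ℝ} (h0 : x ≠ 0) (h1 : |x| ≤ Real.pi / 2) :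
    (1 + 2 * |Real.cos x|) / Real.sin x ^ 2 ≤ 3 / x ^ 2 := by
  wlog hx : 0 < x generalizing x
  · have := this (x := -x) (by simpa using h0) (by simpa using h1)
      (by have := lt_of_le_of_ne (not_lt.mp hx) h0; linarith)
    simpa using this
  rw [abs_of_pos hx] at h1
  have hpi := Real.pi_lt_four
  have hs : 0 < Real.sin x := Real.sin_pos_of_pos_of_lt_pi hx (by linarith)
  rw [abs_of_nonneg (Real.cos_nonneg_of_neg_pi_div_two_le_of_le (by linarith) h1),
    div_le_div_iff₀ (by positivity) (by positivity), mul_comm]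
  exact sq_mul_one_add_two_cos_le hx.le (by linarith)

theorem sum_one_div_sq_le_of_injOn {ι : Type*} (S : Finset ι) (k : ι → ℕ)
    (hk : Set.InjOn k S) : ∑ s ∈ S, 1 / (k s : ℝ) ^ 2 ≤ Real.pi ^ 2 / 6 := by
  rw [← Finset.sum_image (f := fun n : ℕ => 1 / (n : ℝ) ^ 2) hk]
  exact sum_le_hasSum _ (fun _ _ => by positivity) hasSum_zeta_two

/-- Positive numbers that are `Δ`-separated from `0` and from each other lie, in increasing order,
beyond `Δ, 2Δ, 3Δ, …`; Basel's sum then bounds the sum of their inverse squares. -/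
theorem sum_one_div_sq_le_of_separated {ι : Type*} (S : Finset ι) (y : ι → ℝ) {Δ : ℝ}
    (hΔ : 0 < Δ) (hy : ∀ s ∈ S, Δ ≤ y s)
    (hsep : ∀ s ∈ S, ∀ t ∈ S, s ≠ t → Δ ≤ |y s - y t|) :
    ∑ s ∈ S, 1 / y s ^ 2 ≤ Real.pi ^ 2 / (6 * Δ ^ 2) := by
  have hinj : Set.InjOn (fun s => ⌊y s / Δ⌋₊) S := by
    intro s hs t ht hst
    by_contra hne
    have hst' : ⌊y s / Δ⌋₊ = ⌊y t / Δ⌋₊ := hst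
    have h1 := Nat.floor_le (a := y s / Δ) (div_nonneg (hΔ.le.trans (hy s hs)) hΔ.le)
    have h2 := Nat.floor_le (a := y t / Δ) (div_nonneg (hΔ.le.trans (hy t ht)) hΔ.le)
    have h3 := Nat.lt_floor_add_one (y s / Δ)
    have h4 := Nat.lt_floor_add_one (y t / Δ)
    rw [hst'] at h1 h3
    have h5 : |y s / Δ - y t / Δ| < 1 := abs_lt.mpr ⟨by linarith, by linarith⟩
    rw [← sub_div, abs_div, abs_of_pos hΔ, div_lt_one hΔ] at h5
    exact absurd (hsep s hs t ht hne) (not_le.mpr h5)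
  have hle : ∀ s ∈ S, 1 / y s ^ 2 ≤ 1 / (⌊y s / Δ⌋₊ : ℝ) ^ 2 * (1 / Δ ^ 2) := by
    intro s hs
    have h1 := Nat.floor_le (a := y s / Δ) (div_nonneg (hΔ.le.trans (hy s hs)) hΔ.le)
    have h2 : 1 ≤ ⌊y s / Δ⌋₊ := Nat.le_floor (by
      rw [Nat.cast_one, one_le_div hΔ]; exact hy s hs)
    have h3 : (0 : ℝ) < ⌊y s / Δ⌋₊ := by exact_mod_cast h2
    rw [le_div_iff₀ hΔ] at h1
    rw [one_div_mul_one_div, ← mul_pow]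
    exact one_div_le_one_div_of_le (by positivity) (pow_le_pow_left₀ (by positivity) h1 2)
  calc ∑ s ∈ S, 1 / y s ^ 2 ≤ ∑ s ∈ S, 1 / (⌊y s / Δ⌋₊ : ℝ) ^ 2 * (1 / Δ ^ 2) :=
        Finset.sum_le_sum hle
    _ ≤ Real.pi ^ 2 / 6 * (1 / Δ ^ 2) := by
        rw [← Finset.sum_mul]
        gcongr
        exact sum_one_div_sq_le_of_injOn S _ hinj
    _ = Real.pi ^ 2 / (6 * Δ ^ 2) := by
      rw [div_mul_div_comm, mul_one]

/-- The row estimate for Hilbert's inequality, for points that are `Δ`-separated modulo `1`. Six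
times the Basel sum over `π² Δ²` is exactly `1 / Δ²`. The term `s = r` is `0`, because
`x / 0 = 0`. -/
theorem sum_one_add_two_abs_cos_div_sin_sq_le {ι : Type*} [Fintype ι] [DecidableEq ι] (t : ι → ℝ)
    {Δ : ℝ} (hΔ : 0 < Δ) (hsep : ∀ r s, r ≠ s → ∀ k : ℤ, Δ ≤ |t r - t s - k|) (r : ι) :
    ∑ s, (1 + 2 * |Real.cos (Real.pi * t r - Real.pi * t s)|) /
      Real.sin (Real.pi * t r - Real.pi * t s) ^ 2 ≤ (1 / Δ) ^ 2 := by
  -- Representatives of the differences in `[-1/2, 1/2]`; the two signs are summed separately.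
  set y : ι → ℝ := fun s => t r - t s - round (t r - t s) with hy
  have hlow : ∀ s, s ≠ r → Δ ≤ |y s| := fun s hs => hsep r s hs.symm _
  have hyy : ∀ s s', s ≠ s' → Δ ≤ |y s - y s'| := by
    intro s s' hne
    have h := hsep s' s hne.symm (round (t r - t s) - round (t r - t s'))
    have e : y s - y s' = t s' - t s - ((round (t r - t s) - round (t r - t s') : ℤ) : ℝ) := by
      simp only [hy]; push_cast; ring
    rwa [e]
  have hterm : ∀ s, s ≠ r → (1 + 2 * |Real.cos (Real.pi * t r - Real.pi * t s)|) /
      Real.sin (Real.pi * t r - Real.pi * t s) ^ 2 ≤ 3 / Real.pi ^ 2 * (1 / y s ^ 2) := by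
    intro s hs
    have e : Real.pi * t r - Real.pi * t s
        = Real.pi * y s + (round (t r - t s) : ℤ) * Real.pi := by
      simp only [hy]; ring
    have hc : |Real.cos (Real.pi * y s + (round (t r - t s) : ℤ) * Real.pi)|
        = |Real.cos (Real.pi * y s)| := by
      rw [Real.cos_add_int_mul_pi, abs_mul, abs_zpow, abs_neg, abs_one, _root_.one_zpow, one_mul]
    have hsn : Real.sin (Real.pi * y s + (round (t r - t s) : ℤ) * Real.pi) ^ 2
        = Real.sin (Real.pi * y s) ^ 2 := by
      rw [← sq_abs, Real.sin_add_int_mul_pi, abs_mul, abs_zpow, abs_neg, abs_one, _root_.one_zpow,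
        one_mul, sq_abs]
    have hy0 : y s ≠ 0 := by
      intro h0
      have := hlow s hs
      rw [h0, abs_zero] at this
      linarith
    rw [e, hc, hsn]
    refine (one_add_two_abs_cos_div_sin_sq_le (mul_ne_zero Real.pi_ne_zero hy0) ?_).trans_eq ?_
    · rw [abs_mul, abs_of_pos Real.pi_pos]
      have : |y s| ≤ 1 / 2 := abs_sub_round _
      nlinarith [Real.pi_pos]
    · rw [mul_pow]; field_simp
  have hpos : ∑ s ∈ (Finset.univ.erase r).filter (fun s => 0 < y s), 1 / y s ^ 2
      ≤ Real.pi ^ 2 / (6 * Δ ^ 2) := by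
    apply sum_one_div_sq_le_of_separated _ _ hΔ
    · intro s hs
      simp only [Finset.mem_filter, Finset.mem_erase, Finset.mem_univ, and_true] at hs
      exact (hlow s hs.1).trans_eq (abs_of_pos hs.2)
    · exact fun s _ s' _ => hyy s s'
  have hneg : ∑ s ∈ (Finset.univ.erase r).filter (fun s => ¬ 0 < y s), 1 / y s ^ 2
      ≤ Real.pi ^ 2 / (6 * Δ ^ 2) := by
    have := sum_one_div_sq_le_of_separated
      ((Finset.univ.erase r).filter (fun s => ¬ 0 < y s)) (fun s => - y s) hΔ ?_ ?_
    · simpa using this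
    · intro s hs
      simp only [Finset.mem_filter, Finset.mem_erase, Finset.mem_univ, and_true] at hs
      exact (hlow s hs.1).trans_eq (abs_of_nonpos (not_lt.mp hs.2))
    · intro s _ s' _ hne
      rw [show - y s - - y s' = -(y s - y s') by ring, abs_neg]
      exact hyy s s' hne
  rw [← Finset.add_sum_erase _ _ (Finset.mem_univ r)]
  have h0 : (1 + 2 * |Real.cos (Real.pi * t r - Real.pi * t r)|) /
      Real.sin (Real.pi * t r - Real.pi * t r) ^ 2 = 0 := by simp
  rw [h0, zero_add]
  calc _ ≤ ∑ s ∈ Finset.univ.erase r, 3 / Real.pi ^ 2 * (1 / y s ^ 2) :=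
        Finset.sum_le_sum fun s hs => hterm s (Finset.ne_of_mem_erase hs)
    _ = 3 / Real.pi ^ 2 * (∑ s ∈ (Finset.univ.erase r).filter (fun s => 0 < y s), 1 / y s ^ 2 +
          ∑ s ∈ (Finset.univ.erase r).filter (fun s => ¬ 0 < y s), 1 / y s ^ 2) := by
        rw [Finset.sum_filter_add_sum_filter_not, Finset.mul_sum]
    _ ≤ 3 / Real.pi ^ 2 * (Real.pi ^ 2 / (6 * Δ ^ 2) + Real.pi ^ 2 / (6 * Δ ^ 2)) := by
        gcongr
    _ = (1 / Δ) ^ 2 := by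
        have := Real.pi_ne_zero
        field_simp; norm_num

/-! ### Hermitian matrices in an eigenbasis -/

theorem _root_.Matrix.IsHermitian.eq_unitary_mul_diagonal {n : Type*} [Fintype n] [DecidableEq n]
    {T : Matrix n n ℂ} (hT : T.IsHermitian) :
    T = (hT.eigenvectorUnitary : Matrix n n ℂ) *
      Matrix.diagonal (fun i => ((hT.eigenvalues i : ℝ) : ℂ)) *
      (hT.eigenvectorUnitary : Matrix n n ℂ)ᴴ := by
  have h := hT.spectral_theorem
  rw [Unitary.conjStarAlgAut_apply] at h
  exact h

theorem star_dotProduct_self_eq {n : Type*} [Fintype n] (v : n → ℂ) :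
    star v ⬝ᵥ v = ((∑ k, ‖v k‖ ^ 2 : ℝ) : ℂ) := by
  simp only [dotProduct, Pi.star_apply, RCLike.star_def]
  push_cast
  exact Finset.sum_congr rfl fun k _ => Complex.conj_mul' _

theorem star_dotProduct_diagonal_mulVec {n : Type*} [Fintype n] [DecidableEq n] (g : n → ℝ)
    (v : n → ℂ) :
    star v ⬝ᵥ (Matrix.diagonal (fun k => (g k : ℂ)) *ᵥ v) =
      ((∑ k, g k * ‖v k‖ ^ 2 : ℝ) : ℂ) := by
  simp only [dotProduct, Matrix.mulVec_diagonal, Pi.star_apply, RCLike.star_def]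
  push_cast
  refine Finset.sum_congr rfl fun k _ => ?_
  rw [← Complex.conj_mul']; ring

theorem star_dotProduct_mulVec_conj {m n : Type*} [Fintype m] [Fintype n]
    (V : Matrix m n ℂ) (T : Matrix n n ℂ) (v : m → ℂ) :
    star v ⬝ᵥ ((V * T * Vᴴ) *ᵥ v) = star (Vᴴ *ᵥ v) ⬝ᵥ (T *ᵥ (Vᴴ *ᵥ v)) := by
  rw [Matrix.star_mulVec, Matrix.conjTranspose_conjTranspose, ← Matrix.dotProduct_mulVec,
    Matrix.mulVec_mulVec, Matrix.mulVec_mulVec, Matrix.mul_assoc]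

theorem sum_norm_sq_unitary_mulVec {n : Type*} [Fintype n] [DecidableEq n]
    {U : Matrix n n ℂ} (hU : U * Uᴴ = 1) (v : n → ℂ) :
    ∑ k, ‖(Uᴴ *ᵥ v) k‖ ^ 2 = ∑ k, ‖v k‖ ^ 2 := by
  have h := star_dotProduct_mulVec_conj U 1 v
  rw [Matrix.mul_one, hU, Matrix.one_mulVec, Matrix.one_mulVec, star_dotProduct_self_eq,
    star_dotProduct_self_eq] at h
  exact_mod_cast h.symm

/-- The numerical radius of a Hermitian matrix is attained at an eigenvector. -/
theorem norm_star_dotProduct_mulVec_le {n : Type*} [Fintype n] [DecidableEq n]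
    {T : Matrix n n ℂ} (hT : T.IsHermitian) {B : ℝ}
    (hB : ∀ (μ : ℝ) (v : n → ℂ), v ≠ 0 → T *ᵥ v = (μ : ℂ) • v → |μ| ≤ B) (v : n → ℂ) :
    ‖star v ⬝ᵥ (T *ᵥ v)‖ ≤ B * ∑ k, ‖v k‖ ^ 2 := by
  have hU : (hT.eigenvectorUnitary : Matrix n n ℂ) * (hT.eigenvectorUnitary : Matrix n n ℂ)ᴴ = 1 :=
    Unitary.coe_mul_star_self hT.eigenvectorUnitary
  have hev : ∀ k, |hT.eigenvalues k| ≤ B := by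
    intro k
    refine hB _ (hT.eigenvectorBasis k) ?_ ?_
    · intro h0
      refine hT.eigenvectorBasis.orthonormal.ne_zero k ?_
      ext j
      exact congrFun h0 j
    · exact hT.mulVec_eigenvectorBasis k
  have h1 := star_dotProduct_mulVec_conj (hT.eigenvectorUnitary : Matrix n n ℂ)
    (Matrix.diagonal (fun i => ((hT.eigenvalues i : ℝ) : ℂ))) v
  rw [← hT.eq_unitary_mul_diagonal, star_dotProduct_diagonal_mulVec] at h1
  rw [h1, Complex.norm_real, ← sum_norm_sq_unitary_mulVec hU v, Finset.mul_sum]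
  refine (Finset.abs_sum_le_sum_abs _ _).trans (Finset.sum_le_sum fun k _ => ?_)
  rw [abs_mul, abs_of_nonneg (a := ‖_‖ ^ 2) (sq_nonneg _)]
  exact mul_le_mul_of_nonneg_right (hev k) (sq_nonneg _)

/-! ### Hilbert's inequality -/

/-- The matrix `1 / sin (θ r - θ s)` of Hilbert's inequality on the circle. Its diagonal is zero,
because `(sin 0)⁻¹ = 0`. -/
noncomputable def cscMatrix {ι : Type*} (θ : ι → ℝ) : Matrix ι ι ℂ :=
  Matrix.of fun r s => (((Real.sin (θ r - θ s))⁻¹ : ℝ) : ℂ)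

theorem cscMatrix_conjTranspose {ι : Type*} (θ : ι → ℝ) : (cscMatrix θ)ᴴ = - cscMatrix θ := by
  ext r s
  rw [Matrix.conjTranspose_apply, Matrix.neg_apply, cscMatrix, Matrix.of_apply, Matrix.of_apply,
    ← neg_sub (θ r), Real.sin_neg, inv_neg, RCLike.star_def, Complex.conj_ofReal,
    Complex.ofReal_neg]

section Hilbert

variable {ι : Type*} [Fintype ι] [DecidableEq ι]

/-- The identity `csc a csc b = csc (a - b) (cot b - cot a)`, summed over the common argument. The
two terms in which one cosecant is the junk value `1 / 0 = 0` are responsible for the summand with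
the factor `2`. -/
theorem sum_csc_mul_csc {θ : ι → ℝ} (hθ : ∀ r s, r ≠ s → Real.sin (θ r - θ s) ≠ 0) {r t : ι}
    (hrt : r ≠ t) :
    ∑ s, (Real.sin (θ r - θ s))⁻¹ * (Real.sin (θ t - θ s))⁻¹ =
      (Real.sin (θ r - θ t))⁻¹ * (∑ s, Real.cos (θ t - θ s) / Real.sin (θ t - θ s) -
        ∑ s, Real.cos (θ r - θ s) / Real.sin (θ r - θ s)) +
      2 * ((Real.sin (θ r - θ t))⁻¹ * (Real.cos (θ r - θ t) / Real.sin (θ r - θ t))) := by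
  set q := (Real.sin (θ r - θ t))⁻¹ * (Real.cos (θ r - θ t) / Real.sin (θ r - θ t)) with hq
  have hterm : ∀ s, (Real.sin (θ r - θ s))⁻¹ * (Real.sin (θ t - θ s))⁻¹ =
      (Real.sin (θ r - θ t))⁻¹ * (Real.cos (θ t - θ s) / Real.sin (θ t - θ s) -
        Real.cos (θ r - θ s) / Real.sin (θ r - θ s)) + (if s = r then q else 0) +
        (if s = t then q else 0) := by
    intro s
    by_cases hsr : s = r
    · subst hsr
      rw [if_pos rfl, if_neg hrt, hq, ← neg_sub (θ s) (θ t), Real.sin_neg, Real.cos_neg]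
      simp [div_neg]
    · by_cases hst : s = t
      · subst hst
        rw [if_pos rfl, if_neg hsr, hq]
        simp
      · rw [if_neg hsr, if_neg hst]
        have h1 := hθ r s (Ne.symm hsr)
        have h2 := hθ t s (Ne.symm hst)
        have h3 := hθ r t hrt
        have h4 : Real.sin (θ r - θ t) = Real.sin (θ r - θ s) * Real.cos (θ t - θ s) -
            Real.cos (θ r - θ s) * Real.sin (θ t - θ s) := by
          rw [← Real.sin_sub]; congr 1; ring
        rw [div_sub_div _ _ h2 h1, add_zero, add_zero, inv_mul_eq_div,
          show Real.cos (θ t - θ s) * Real.sin (θ r - θ s) -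
            Real.sin (θ t - θ s) * Real.cos (θ r - θ s) = Real.sin (θ r - θ t) by rw [h4]; ring]
        field_simp
  simp only [hterm, Finset.sum_add_distrib, ← Finset.mul_sum, Finset.sum_sub_distrib]
  simp
  ring

/-- The eigenvalue estimate behind Hilbert's inequality, following Montgomery and Vaughan: in
`‖H v‖²` the off-diagonal part is a commutator of `H` with a real diagonal matrix, which an
eigenvector `v` does not see, plus a remainder that is estimated trivially. -/
theorem abs_eigenvalue_cscMatrix_le {θ : ι → ℝ}
    (hθ : ∀ r s, r ≠ s → Real.sin (θ r - θ s) ≠ 0) {B : ℝ} (hB0 : 0 ≤ B)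
    (hB : ∀ r, ∑ s, (1 + 2 * |Real.cos (θ r - θ s)|) / Real.sin (θ r - θ s) ^ 2 ≤ B ^ 2)
    {μ : ℝ} {v : ι → ℂ} (hv : v ≠ 0)
    (hμ : (Complex.I • cscMatrix θ) *ᵥ v = (μ : ℂ) • v) : |μ| ≤ B := by
  set H := cscMatrix θ with hH
  set cot : ι → ι → ℝ := fun r s => Real.cos (θ r - θ s) / Real.sin (θ r - θ s) with hcot
  set csc : ι → ι → ℝ := fun r s => (Real.sin (θ r - θ s))⁻¹ with hcsc
  set C : Matrix ι ι ℂ := Matrix.diagonal fun r => ((∑ s, cot r s : ℝ) : ℂ) with hC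
  set e : ι → ι → ℝ := fun r t =>
    2 * (csc r t * cot r t) + if r = t then ∑ s, csc r s ^ 2 else 0 with he
  set E : Matrix ι ι ℂ := Matrix.of fun r t => (e r t : ℂ) with hE
  have hmat : Hᴴ * H = H * C - C * H + E := by
    have h1 : Hᴴ * H = H * Hᴴ := by rw [hH, cscMatrix_conjTranspose]; simp
    rw [h1]
    ext r t
    rw [Matrix.mul_apply, Matrix.add_apply, Matrix.sub_apply, hC, Matrix.mul_diagonal,
      Matrix.diagonal_mul, hE, Matrix.of_apply]
    have h2 : ∀ s, H r s * Hᴴ s t = ((csc r s * csc t s : ℝ) : ℂ) := by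
      intro s
      rw [Matrix.conjTranspose_apply, hH, cscMatrix, Matrix.of_apply, Matrix.of_apply,
        RCLike.star_def, Complex.conj_ofReal, Complex.ofReal_mul]
    have h3 : H r t = (csc r t : ℂ) := rfl
    simp only [h2, h3]
    rw [← Complex.ofReal_sum, ← Complex.ofReal_mul, ← Complex.ofReal_mul, ← Complex.ofReal_sub,
      ← Complex.ofReal_add]
    congr 1
    by_cases hrt : r = t
    · subst hrt
      simp [he, hcsc, hcot, sq]
    · simp only [he, if_neg hrt, hcsc, hcot]
      rw [sum_csc_mul_csc hθ hrt]
      ring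
  have hHv : H *ᵥ v = (-Complex.I * μ) • v := by
    rw [Matrix.smul_mulVec] at hμ
    rw [mul_smul, ← hμ, smul_smul]
    simp
  have hHs : star v ᵥ* H = (-Complex.I * μ) • star v := by
    have h1 : star (H *ᵥ v) = - (star v ᵥ* H) := by
      rw [Matrix.star_mulVec, hH, cscMatrix_conjTranspose, Matrix.vecMul_neg]
    rw [← neg_eq_iff_eq_neg.mpr h1, hHv, star_smul]
    simp
  -- The eigenvalue `-I μ` of `H` is imaginary, so `v` and `star v` contribute the same factor.
  have hcomm : star v ⬝ᵥ ((H * C - C * H) *ᵥ v) = 0 := by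
    rw [Matrix.sub_mulVec, ← Matrix.mulVec_mulVec, ← Matrix.mulVec_mulVec, dotProduct_sub,
      Matrix.dotProduct_mulVec, hHs, hHv, Matrix.mulVec_smul, smul_dotProduct, dotProduct_smul,
      sub_self]
  have hnorm : ((μ ^ 2 * ∑ k, ‖v k‖ ^ 2 : ℝ) : ℂ) = star v ⬝ᵥ (E *ᵥ v) := by
    have h1 : star v ⬝ᵥ ((Hᴴ * H) *ᵥ v) = ((μ ^ 2 * ∑ k, ‖v k‖ ^ 2 : ℝ) : ℂ) := by
      rw [← Matrix.mulVec_mulVec, Matrix.dotProduct_mulVec, ← Matrix.star_mulVec, hHv,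
        star_smul, smul_dotProduct, dotProduct_smul, star_dotProduct_self_eq]
      simp only [smul_eq_mul, RCLike.star_def, map_mul, map_neg, Complex.conj_I,
        Complex.conj_ofReal]
      push_cast
      linear_combination (-(μ : ℂ) ^ 2 * ∑ k, (‖v k‖ : ℂ) ^ 2) * Complex.I_sq
    rw [← h1, hmat, Matrix.add_mulVec, dotProduct_add, hcomm, zero_add]
  have hsymm : ∀ r t, |csc r t * cot r t| = |csc t r * cot t r| := by
    intro r t
    simp only [hcsc, hcot]
    rw [← neg_sub (θ t) (θ r), Real.sin_neg, Real.cos_neg]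
    simp [abs_mul, abs_div]
  have hrem : ‖star v ⬝ᵥ (E *ᵥ v)‖ ≤ B ^ 2 * ∑ k, ‖v k‖ ^ 2 := by
    have h1 : ‖star v ⬝ᵥ (E *ᵥ v)‖ ≤ ∑ r, ∑ t, |e r t| * (‖v r‖ * ‖v t‖) := by
      simp only [dotProduct, Matrix.mulVec]
      refine (norm_sum_le _ _).trans (Finset.sum_le_sum fun r _ => ?_)
      rw [norm_mul]
      refine (mul_le_mul_of_nonneg_left (norm_sum_le _ _) (norm_nonneg _)).trans_eq ?_
      rw [Finset.mul_sum]
      refine Finset.sum_congr rfl fun t _ => ?_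
      rw [norm_mul, hE, Matrix.of_apply, Complex.norm_real, Pi.star_apply, norm_star,
        Real.norm_eq_abs]
      ring
    -- `2 |v r| |v t| ≤ |v r|² + |v t|²`, split so that each half is summed over one index.
    have h2 : ∀ r t, |e r t| * (‖v r‖ * ‖v t‖) ≤
        |csc r t * cot r t| * ‖v r‖ ^ 2 + |csc t r * cot t r| * ‖v t‖ ^ 2 +
          if r = t then (∑ s, csc r s ^ 2) * ‖v r‖ ^ 2 else 0 := by
      intro r t
      rw [← hsymm r t]
      have h3 : |e r t| ≤ 2 * |csc r t * cot r t| + if r = t then ∑ s, csc r s ^ 2 else 0 := by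
        refine (abs_add_le _ _).trans (add_le_add ?_ ?_)
        · rw [abs_mul, abs_two]
        · split_ifs
          · rw [abs_of_nonneg (Finset.sum_nonneg fun s _ => sq_nonneg _)]
          · simp
      refine (mul_le_mul_of_nonneg_right h3 (by positivity)).trans ?_
      rw [add_mul]
      refine add_le_add ?_ ?_
      · nlinarith [mul_nonneg (abs_nonneg (csc r t * cot r t)) (sq_nonneg (‖v r‖ - ‖v t‖))]
      · split_ifs with h
        · subst h; rw [sq ‖v r‖]
        · simp
    have h4 : ∀ r s, (1 + 2 * |Real.cos (θ r - θ s)|) / Real.sin (θ r - θ s) ^ 2 =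
        2 * |csc r s * cot r s| + csc r s ^ 2 := by
      intro r s
      simp only [hcsc, hcot]
      rw [abs_mul, abs_div, abs_inv, inv_pow, ← sq_abs (Real.sin _)]
      ring
    have h5 : ∑ r, ∑ t, |csc t r * cot t r| * ‖v t‖ ^ 2 =
        ∑ r, ∑ t, |csc r t * cot r t| * ‖v r‖ ^ 2 := Finset.sum_comm
    calc _ ≤ _ := h1
      _ ≤ _ := Finset.sum_le_sum fun r _ => Finset.sum_le_sum fun t _ => h2 r t
      _ = ∑ r, (∑ s, (1 + 2 * |Real.cos (θ r - θ s)|) / Real.sin (θ r - θ s) ^ 2) *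
            ‖v r‖ ^ 2 := by
          simp only [Finset.sum_add_distrib, h4, h5, add_mul, ← Finset.mul_sum, ← Finset.sum_mul,
            Finset.sum_ite_eq, Finset.mem_univ, if_true]
          rw [← Finset.sum_add_distrib]
          congr 1
          refine Finset.sum_congr rfl fun r _ => ?_
          ring
      _ ≤ ∑ r, B ^ 2 * ‖v r‖ ^ 2 := Finset.sum_le_sum fun r _ =>
          mul_le_mul_of_nonneg_right (hB r) (sq_nonneg _)
      _ = _ := (Finset.mul_sum _ _ _).symm
  have hvpos : 0 < ∑ k, ‖v k‖ ^ 2 := by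
    obtain ⟨k, hk⟩ := Function.ne_iff.mp hv
    exact Finset.sum_pos' (fun _ _ => sq_nonneg _)
      ⟨k, Finset.mem_univ _, pow_pos (norm_pos_iff.mpr hk) 2⟩
  rw [← hnorm, Complex.norm_real, Real.norm_eq_abs, abs_of_nonneg (by positivity)] at hrem
  exact abs_le_of_sq_le_sq (le_of_mul_le_mul_right hrem hvpos) hB0

/-- Hilbert's inequality for the kernel `1 / sin`, with a constant `B` read off from row sums. -/
theorem norm_star_dotProduct_cscMatrix_le {θ : ι → ℝ}
    (hθ : ∀ r s, r ≠ s → Real.sin (θ r - θ s) ≠ 0) {B : ℝ} (hB0 : 0 ≤ B)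
    (hB : ∀ r, ∑ s, (1 + 2 * |Real.cos (θ r - θ s)|) / Real.sin (θ r - θ s) ^ 2 ≤ B ^ 2)
    (v : ι → ℂ) : ‖star v ⬝ᵥ (cscMatrix θ *ᵥ v)‖ ≤ B * ∑ k, ‖v k‖ ^ 2 := by
  have hT : (Complex.I • cscMatrix θ).IsHermitian := by
    rw [Matrix.IsHermitian, Matrix.conjTranspose_smul, cscMatrix_conjTranspose]
    simp
  have h := norm_star_dotProduct_mulVec_le hT
    (fun μ w hw hμ => abs_eigenvalue_cscMatrix_le hθ hB0 hB hw hμ) v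
  rwa [Matrix.smul_mulVec, dotProduct_smul, smul_eq_mul, norm_mul, Complex.norm_I, one_mul] at h

end Hilbert

/-! ### The large sieve inequality for the Gram matrix -/

variable {N M : ℕ}

theorem sum_grid_telescope (hN : Even N) (f : ℤ → ℂ) :
    ∑ n : Grid N, (f (n.1 + 1) - f n.1) = f (N / 2) - f (-(N / 2)) := by
  obtain ⟨K, rfl⟩ := hN
  have hK : ((K + K : ℕ) : ℤ) / 2 = K := by omega
  rw [Finset.sum_coe_sort (Finset.Ico (-(((K + K : ℕ) : ℤ) / 2)) (((K + K : ℕ) : ℤ) / 2))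
    (fun n => f (n + 1) - f n), hK]
  have h := Finset.sum_Ico_int_sub K f
  rw [Finset.sum_sub_distrib] at h ⊢
  linear_combination -h

theorem card_grid (hN : Even N) : Fintype.card (Grid N) = N := by
  rw [Fintype.card_coe, Int.card_Ico]
  obtain ⟨K, rfl⟩ := hN
  omega

/-- The closed form of the Dirichlet kernel. -/
theorem sum_grid_exp_mul_sin (hN : Even N) (α : ℝ) :
    (∑ n : Grid N, Complex.exp (2 * n.1 * α * Complex.I)) * (2 * Complex.I * Real.sin α) =
      Complex.exp ((N - 1) * α * Complex.I) - Complex.exp (-((N + 1) * α * Complex.I)) := by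
  have hN2 : (((N : ℤ) / 2 : ℤ) : ℂ) = (N : ℂ) / 2 := by
    obtain ⟨K, rfl⟩ := hN
    have hK : ((K + K : ℕ) : ℤ) / 2 = K := by omega
    rw [hK]; push_cast; ring
  have h := sum_grid_telescope hN (fun n => Complex.exp ((2 * n - 1) * α * Complex.I))
  have hs : 2 * Complex.I * Real.sin α =
      Complex.exp (α * Complex.I) - Complex.exp (-(α * Complex.I)) := by
    rw [Complex.ofReal_sin, Complex.sin]
    linear_combination (Complex.exp (-α * Complex.I) - Complex.exp (α * Complex.I)) *
      Complex.I_sq + (by ring_nf : Complex.exp (-α * Complex.I) = Complex.exp (-(α * Complex.I)))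
        * (-1 : ℂ)
  rw [Finset.sum_mul, hs]
  simp only [mul_sub, ← Complex.exp_add]
  convert h using 1
  · refine Finset.sum_congr rfl fun n _ => ?_
    congr 2 <;> push_cast <;> ring
  · congr 2
    · rw [hN2]; ring
    · rw [Int.cast_neg, hN2]; ring

theorem gram_apply (Ξ : Fin M → ℝ) (r s : Fin M) :
    ((vander N Ξ)ᴴ * vander N Ξ) r s = (1 / N : ℂ) *
      ∑ n : Grid N, Complex.exp (2 * n.1 * (Real.pi * (Ξ s - Ξ r) / N : ℝ) * Complex.I) := by
  have hsq : (1 / (Real.sqrt N : ℂ)) * (1 / (Real.sqrt N : ℂ)) = 1 / N := by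
    rw [div_mul_div_comm, one_mul, ← Complex.ofReal_mul, Real.mul_self_sqrt (Nat.cast_nonneg N),
      Complex.ofReal_natCast]
  rw [Matrix.mul_apply, Finset.mul_sum]
  refine Finset.sum_congr rfl fun n _ => ?_
  rw [Matrix.conjTranspose_apply, vander, Matrix.of_apply, Matrix.of_apply, ← hsq,
    RCLike.star_def, map_mul, ← Complex.exp_conj, mul_mul_mul_comm, ← Complex.exp_add]
  congr 2
  · simp
  · simp only [map_mul, map_div₀, map_ofNat, Complex.conj_I, Complex.conj_ofReal, map_intCast,
      map_natCast]
    push_cast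
    ring

theorem gram_apply_self (hN : Even N) (hN0 : 0 < N) (Ξ : Fin M → ℝ) (r : Fin M) :
    ((vander N Ξ)ᴴ * vander N Ξ) r r = 1 := by
  rw [gram_apply]
  have : (N : ℂ) ≠ 0 := by exact_mod_cast hN0.ne'
  rw [sub_self, mul_zero, zero_div, Complex.ofReal_zero]
  simp only [mul_zero, zero_mul, Complex.exp_zero, Finset.sum_const, Finset.card_univ,
    card_grid hN, nsmul_eq_mul, mul_one]
  exact one_div_mul_cancel this

theorem sin_ne_zero_of_separated {t Δ : ℝ} (hΔ : 0 < Δ) (h : ∀ k : ℤ, Δ ≤ |t - k|) :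
    Real.sin (Real.pi * t) ≠ 0 := by
  intro h0
  obtain ⟨k, hk⟩ := Real.sin_eq_zero_iff.mp h0
  have h1 := h k
  have h2 : t = k := mul_left_cancel₀ Real.pi_ne_zero (by rw [← hk]; ring)
  rw [h2, sub_self, abs_zero] at h1
  linarith

/-- The sharp large sieve inequality, in both directions: the quadratic form of the Gram matrix of
`D`-separated frequencies differs from the identity by at most `1 / D`. The Dirichlet kernel is the
difference of two unitarily twisted copies of Hilbert's matrix, each of which contributes half. -/
theorem norm_gram_sub_le (hN : Even N) (hN0 : 0 < N) (Ξ : Fin M → ℝ) {D : ℝ} (hD : 0 < D)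
    (hsep : ∀ r s, r ≠ s → ∀ k : ℤ, D ≤ |Ξ r - Ξ s - k * N|) (x : Fin M → ℂ) :
    ‖star x ⬝ᵥ (((vander N Ξ)ᴴ * vander N Ξ - 1) *ᵥ x)‖ ≤ 1 / D * ∑ k, ‖x k‖ ^ 2 := by
  have hNR : (0 : ℝ) < N := by exact_mod_cast hN0
  have hNC : (N : ℂ) ≠ 0 := by exact_mod_cast hN0.ne'
  set t : Fin M → ℝ := fun r => Ξ r / N with ht
  have hΔ : 0 < D / N := by positivity
  have hsep' : ∀ r s, r ≠ s → ∀ k : ℤ, D / N ≤ |t r - t s - k| := by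
    intro r s hrs k
    have e : t r - t s - k = (Ξ r - Ξ s - k * N) / N := by simp only [ht]; field_simp
    rw [e, abs_div, abs_of_pos hNR]
    exact div_le_div_of_nonneg_right (hsep r s hrs k) hNR.le
  set θ : Fin M → ℝ := fun r => Real.pi * t r with hθdef
  have hθ : ∀ r s, r ≠ s → Real.sin (θ r - θ s) ≠ 0 := by
    intro r s hrs
    simp only [hθdef, ← mul_sub]
    exact sin_ne_zero_of_separated hΔ (hsep' r s hrs)
  have hH := norm_star_dotProduct_cscMatrix_le hθ (B := 1 / (D / N)) (by positivity)
    (sum_one_add_two_abs_cos_div_sin_sq_le t hΔ hsep')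
  set a : Fin M → ℂ := fun r => Complex.exp ((N - 1) * θ r * Complex.I) with ha
  set b : Fin M → ℂ := fun r => Complex.exp (-((N + 1) * θ r * Complex.I)) with hb
  have hna : ∀ r, ‖a r‖ = 1 := by
    intro r
    have : ((N : ℂ) - 1) * θ r * Complex.I = (((N - 1) * θ r : ℝ) : ℂ) * Complex.I := by
      push_cast; ring
    rw [ha]
    simp only
    rw [this, Complex.norm_exp_ofReal_mul_I]
  have hnb : ∀ r, ‖b r‖ = 1 := by
    intro r
    have : -(((N : ℂ) + 1) * θ r * Complex.I) = ((-((N + 1) * θ r) : ℝ) : ℂ) * Complex.I := by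
      push_cast; ring
    rw [hb]
    simp only
    rw [this, Complex.norm_exp_ofReal_mul_I]
  -- On the diagonal both sides vanish: `a` and `b` are unimodular and `cscMatrix` is zero there.
  have hentry : ∀ r s, ((vander N Ξ)ᴴ * vander N Ξ - 1 : Matrix (Fin M) (Fin M) ℂ) r s =
      Complex.I / (2 * N) * (star (a r) * a s - star (b r) * b s) * cscMatrix θ r s := by
    intro r s
    rw [Matrix.sub_apply]
    by_cases hrs : r = s
    · subst hrs
      rw [gram_apply_self hN hN0, Matrix.one_apply_eq, cscMatrix, Matrix.of_apply]
      simp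
    · rw [Matrix.one_apply_ne hrs, gram_apply, sub_zero]
      have h1 := sum_grid_exp_mul_sin hN (θ s - θ r)
      have h2 : Real.pi * (Ξ s - Ξ r) / N = θ s - θ r := by simp only [hθdef, ht]; ring
      have h3 : star (a r) * a s = Complex.exp ((N - 1) * (θ s - θ r : ℝ) * Complex.I) := by
        simp only [ha, RCLike.star_def, ← Complex.exp_conj, ← Complex.exp_add]
        congr 1
        simp
        ring
      have h4 : star (b r) * b s = Complex.exp (-((N + 1) * (θ s - θ r : ℝ) * Complex.I)) := by
        simp only [hb, RCLike.star_def, ← Complex.exp_conj, ← Complex.exp_add]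
        congr 1
        simp
        ring
      have h5 : (Real.sin (θ s - θ r) : ℂ) ≠ 0 := by exact_mod_cast hθ s r (Ne.symm hrs)
      rw [h2, h3, h4, ← h1, cscMatrix, Matrix.of_apply, ← neg_sub (θ s), Real.sin_neg]
      generalize (∑ n : Grid N, Complex.exp (2 * n.1 * (θ s - θ r : ℝ) * Complex.I)) = S
      rw [Complex.ofReal_inv, Complex.ofReal_neg]
      field_simp
      linear_combination S * Complex.I_sq
  have hquad : star x ⬝ᵥ (((vander N Ξ)ᴴ * vander N Ξ - 1) *ᵥ x) = Complex.I / (2 * N) *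
      (star (fun r => a r * x r) ⬝ᵥ (cscMatrix θ *ᵥ fun r => a r * x r) -
        star (fun r => b r * x r) ⬝ᵥ (cscMatrix θ *ᵥ fun r => b r * x r)) := by
    simp only [dotProduct, Matrix.mulVec, hentry, Finset.mul_sum, ← Finset.sum_sub_distrib,
      Pi.star_apply, star_mul']
    refine Finset.sum_congr rfl fun r _ => Finset.sum_congr rfl fun s _ => ?_
    ring
  have hA := hH (fun r => a r * x r)
  have hB := hH (fun r => b r * x r)
  simp only [norm_mul, hna, hnb, one_mul] at hA hB
  rw [hquad, norm_mul, norm_div, norm_mul, Complex.norm_I, RCLike.norm_ofNat, Complex.norm_natCast]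
  calc _ ≤ 1 / (2 * N) * (1 / (D / N) * ∑ k, ‖x k‖ ^ 2 + 1 / (D / N) * ∑ k, ‖x k‖ ^ 2) := by
        gcongr
        exact (norm_sub_le _ _).trans (add_le_add hA hB)
    _ = _ := by field_simp; ring

/-- Every eigenvalue of the Gram matrix of `D`-separated frequencies is within `1 / D` of `1`. -/
theorem abs_gram_eigenvalue_sub_one_le (hN : Even N) (hN0 : 0 < N) (Ξ : Fin M → ℝ) {D : ℝ}
    (hD : 0 < D) (hsep : ∀ r s, r ≠ s → ∀ k : ℤ, D ≤ |Ξ r - Ξ s - k * N|) (k : Fin M) :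
    |(Matrix.isHermitian_conjTranspose_mul_self (vander N Ξ)).eigenvalues k - 1| ≤ 1 / D := by
  set hG := Matrix.isHermitian_conjTranspose_mul_self (vander N Ξ)
  set v : Fin M → ℂ := (hG.eigenvectorBasis k).ofLp with hv
  have hev : ((vander N Ξ)ᴴ * vander N Ξ) *ᵥ v = (hG.eigenvalues k : ℂ) • v :=
    hG.mulVec_eigenvectorBasis k
  have hv1 : ∑ j, ‖v j‖ ^ 2 = 1 := by
    rw [← EuclideanSpace.norm_sq_eq, hG.eigenvectorBasis.orthonormal.1 k, one_pow]
  have h := norm_gram_sub_le hN hN0 Ξ hD hsep v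
  rw [Matrix.sub_mulVec, hev, Matrix.one_mulVec, dotProduct_sub, dotProduct_smul,
    star_dotProduct_self_eq, hv1, mul_one, smul_eq_mul, Complex.ofReal_one, mul_one,
    ← Complex.ofReal_one, ← Complex.ofReal_sub, Complex.norm_real] at h
  exact h

/-! ### Second moments of white noise -/

instance isProbabilityMeasure_complexGaussian (σ : ℝ) :
    IsProbabilityMeasure (complexGaussian σ) :=
  Measure.isProbabilityMeasure_map (MeasurableEquiv.measurable _).aemeasurable

instance isProbabilityMeasure_whiteNoise (M : ℕ) (σ : ℝ) :
    IsProbabilityMeasure (whiteNoise M σ) := by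
  unfold whiteNoise; infer_instance

theorem measurableEquivRealProd_symm_eq (p : ℝ × ℝ) :
    Complex.measurableEquivRealProd.symm p = (p.1 : ℂ) + p.2 * Complex.I :=
  (Complex.mk_eq_add_mul_I _ _)

theorem memLp_complexGaussian (σ : ℝ) : MemLp (fun z : ℂ => z) 2 (complexGaussian σ) := by
  unfold complexGaussian
  rw [← Function.id_def, memLp_map_measure_iff aestronglyMeasurable_id
    (MeasurableEquiv.measurable _).aemeasurable]
  set γ := gaussianReal 0 (Real.toNNReal (σ ^ 2 / 2))
  have h : MemLp (fun x : ℝ => x) 2 γ := memLp_id_gaussianReal 2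
  have h1 : MemLp (fun p : ℝ × ℝ => p.1) 2 (γ.prod γ) :=
    h.comp_measurePreserving measurePreserving_fst
  have h2 : MemLp (fun p : ℝ × ℝ => p.2) 2 (γ.prod γ) :=
    h.comp_measurePreserving measurePreserving_snd
  have h3 := h1.ofReal (K := ℂ) |>.add ((h2.ofReal (K := ℂ)).mul_const Complex.I)
  exact h3.ae_eq (ae_of_all _ fun p => (measurableEquivRealProd_symm_eq p).symm)

theorem integral_complexGaussian (σ : ℝ) : ∫ z, z ∂(complexGaussian σ) = 0 := by
  unfold complexGaussian
  rw [integral_map_equiv]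
  set γ := gaussianReal 0 (Real.toNNReal (σ ^ 2 / 2))
  have h : Integrable (fun x : ℝ => x) γ := (memLp_id_gaussianReal 1).integrable le_rfl
  have h1 : Integrable (fun p : ℝ × ℝ => (p.1 : ℂ)) (γ.prod γ) := (h.comp_fst γ).ofReal
  have h2 : Integrable (fun p : ℝ × ℝ => (p.2 : ℂ) * Complex.I) (γ.prod γ) :=
    (h.comp_snd γ).ofReal.mul_const _
  simp only [measurableEquivRealProd_symm_eq]
  rw [integral_add h1 h2, integral_mul_const]
  have e1 := integral_fun_fst (μ := γ) (ν := γ) (fun x : ℝ => (x : ℂ))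
  have e2 := integral_fun_snd (μ := γ) (ν := γ) (fun x : ℝ => (x : ℂ))
  have e3 : ∫ x, (x : ℂ) ∂γ = 0 := by
    
    have h3 := integral_ofReal (𝕜 := ℂ) (μ := γ) (f := fun x : ℝ => x)
    rw [integral_id_gaussianReal] at h3
    simpa using h3
  rw [e1, e2, e3]
  simp

theorem integral_norm_sq_complexGaussian (σ : ℝ) :
    ∫ z, ‖z‖ ^ 2 ∂(complexGaussian σ) = σ ^ 2 := by
  unfold complexGaussian
  rw [integral_map_equiv]
  set v := Real.toNNReal (σ ^ 2 / 2) with hv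
  set γ := gaussianReal 0 v
  have h : Integrable (fun x : ℝ => x ^ 2) γ := (memLp_id_gaussianReal 2).integrable_sq
  have h1 : Integrable (fun p : ℝ × ℝ => p.1 ^ 2) (γ.prod γ) := h.comp_fst γ
  have h2 : Integrable (fun p : ℝ × ℝ => p.2 ^ 2) (γ.prod γ) := h.comp_snd γ
  have h3 : ∀ p : ℝ × ℝ, ‖Complex.measurableEquivRealProd.symm p‖ ^ 2 = p.1 ^ 2 + p.2 ^ 2 := by
    intro p
    rw [measurableEquivRealProd_symm_eq, ← Complex.normSq_eq_norm_sq, Complex.normSq_add_mul_I]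
  simp only [h3]
  rw [integral_add h1 h2]
  have e1 := integral_fun_fst (μ := γ) (ν := γ) (fun x : ℝ => x ^ 2)
  have e2 := integral_fun_snd (μ := γ) (ν := γ) (fun x : ℝ => x ^ 2)
  have e3 : ∫ x, x ^ 2 ∂γ = σ ^ 2 / 2 := by
    have h4 : Var[fun x ↦ x; γ] = v := variance_fun_id_gaussianReal
    rw [variance_of_integral_eq_zero (X := fun x : ℝ => x) aemeasurable_id
      integral_id_gaussianReal, hv,
      Real.coe_toNNReal _ (by positivity)] at h4
    exact h4
  rw [e1, e2, e3]
  simp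

theorem memLp_whiteNoise (M : ℕ) (σ : ℝ) (m : Fin M) :
    MemLp (fun w : Fin M → ℂ => w m) 2 (whiteNoise M σ) :=
  (memLp_complexGaussian σ).comp_measurePreserving
    (measurePreserving_eval (fun _ : Fin M => complexGaussian σ) m)

theorem integral_whiteNoise (M : ℕ) (σ : ℝ) (m : Fin M) :
    ∫ w : Fin M → ℂ, w m ∂(whiteNoise M σ) = 0 := by
  rw [whiteNoise, integral_comp_eval (μ := fun _ : Fin M => complexGaussian σ) (i := m)
    (f := fun z : ℂ => z) aestronglyMeasurable_id]
  exact integral_complexGaussian σ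

theorem integral_mul_star_whiteNoise (M : ℕ) (σ : ℝ) (m k : Fin M) :
    ∫ w : Fin M → ℂ, w m * star (w k) ∂(whiteNoise M σ) =
      if m = k then ((σ ^ 2 : ℝ) : ℂ) else 0 := by
  split_ifs with h
  · subst h
    have h1 : ∀ w : Fin M → ℂ, w m * star (w m) = ((‖w m‖ ^ 2 : ℝ) : ℂ) := by
      intro w
      rw [RCLike.star_def, Complex.mul_conj']; push_cast; rfl
    simp only [h1]
    rw [integral_complex_ofReal, whiteNoise,
      integral_comp_eval (μ := fun _ : Fin M => complexGaussian σ) (i := m)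
        (f := fun z : ℂ => ‖z‖ ^ 2) (by fun_prop), integral_norm_sq_complexGaussian]
  · have hi : iIndepFun (fun (i : Fin M) (w : Fin M → ℂ) => w i) (whiteNoise M σ) :=
      iIndepFun_pi (μ := fun _ : Fin M => complexGaussian σ) (X := fun _ z => z)
        fun _ => aemeasurable_id
    have h2 := (hi.indepFun h).comp (measurable_id : Measurable fun z : ℂ => z)
      (continuous_star.measurable : Measurable fun z : ℂ => star z)
    have h3 := h2.integral_fun_mul_eq_mul_integral
      (memLp_whiteNoise M σ m).aestronglyMeasurable
      (continuous_star.comp_aestronglyMeasurable (memLp_whiteNoise M σ k).aestronglyMeasurable)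
    simp only [Function.comp_def, id] at h3
    rw [h3, integral_whiteNoise, zero_mul]

/-- The bias-variance decomposition `E |c + ∑ ρ_m w_m|² = |c|² + σ² ∑ |ρ_m|²` for white noise. -/
theorem integral_norm_sq_add_sum_whiteNoise {M : ℕ} (σ : ℝ) (c : ℂ) (ρ : Fin M → ℂ) :
    Integrable (fun w : Fin M → ℂ => ‖c + ∑ m, ρ m * w m‖ ^ 2) (whiteNoise M σ) ∧
    ∫ w : Fin M → ℂ, ‖c + ∑ m, ρ m * w m‖ ^ 2 ∂(whiteNoise M σ) =
      ‖c‖ ^ 2 + σ ^ 2 * ∑ m, ‖ρ m‖ ^ 2 := by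
  set P := whiteNoise M σ with hP
  have hX : MemLp (fun w : Fin M → ℂ => ∑ m, ρ m * w m) 2 P :=
    memLp_finsetSum _ fun m _ => (memLp_whiteNoise M σ m).const_mul (ρ m)
  have hint := (((memLp_const c).add hX).integrable_norm_pow two_ne_zero :
    Integrable (fun w : Fin M → ℂ => ‖c + ∑ m, ρ m * w m‖ ^ 2) P)
  refine ⟨hint, ?_⟩
  have hsum : ∫ w, ∑ m, ρ m * w m ∂P = 0 := by
    rw [integral_finsetSum _ fun m _ =>
      ((memLp_whiteNoise M σ m).integrable one_le_two).const_mul (ρ m)]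
    refine Finset.sum_eq_zero fun m _ => ?_
    rw [integral_const_mul, integral_whiteNoise, mul_zero]
  have hprod : ∀ m k, Integrable (fun w : Fin M → ℂ => w m * star (w k)) P := fun m k =>
    (memLp_whiteNoise M σ m).integrable_mul (memLp_whiteNoise M σ k).star
  have hsq : ∫ w, (∑ m, ρ m * w m) * star (∑ m, ρ m * w m) ∂P =
      ((σ ^ 2 * ∑ m, ‖ρ m‖ ^ 2 : ℝ) : ℂ) := by
    have h1 : ∀ w : Fin M → ℂ, (∑ m, ρ m * w m) * star (∑ m, ρ m * w m) =
        ∑ m, ∑ k, (ρ m * star (ρ k)) * (w m * star (w k)) := by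
      intro w
      rw [star_sum, Finset.sum_mul_sum]
      refine Finset.sum_congr rfl fun m _ => Finset.sum_congr rfl fun k _ => ?_
      rw [star_mul']; ring
    simp only [h1]
    rw [integral_finsetSum _ fun m _ => integrable_finsetSum _ fun k _ =>
      (hprod m k).const_mul _]
    push_cast
    rw [Finset.mul_sum]
    refine Finset.sum_congr rfl fun m _ => ?_
    rw [integral_finsetSum _ fun k _ => (hprod m k).const_mul _]
    simp only [integral_const_mul, hP, integral_mul_star_whiteNoise, mul_ite, mul_zero,
      Finset.sum_ite_eq, Finset.mem_univ, if_true]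
    rw [RCLike.star_def, Complex.mul_conj']
    push_cast
    ring
  have hXi : Integrable (fun w : Fin M → ℂ => ∑ m, ρ m * w m) P := hX.integrable one_le_two
  have hcross : ∫ w, star (∑ m, ρ m * w m) ∂P = 0 := by
    have := integral_conj (μ := P) (f := fun w : Fin M → ℂ => ∑ m, ρ m * w m)
    rw [hsum, map_zero] at this
    exact this
  have hC : ((∫ w, ‖c + ∑ m, ρ m * w m‖ ^ 2 ∂P : ℝ) : ℂ) =
      ((‖c‖ ^ 2 + σ ^ 2 * ∑ m, ‖ρ m‖ ^ 2 : ℝ) : ℂ) := by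
    rw [← integral_complex_ofReal]
    have h1 : ∀ w : Fin M → ℂ, ((‖c + ∑ m, ρ m * w m‖ ^ 2 : ℝ) : ℂ) =
        ((c * star c + star c * ∑ m, ρ m * w m) + c * star (∑ m, ρ m * w m)) +
          (∑ m, ρ m * w m) * star (∑ m, ρ m * w m) := by
      intro w
      rw [Complex.ofReal_pow, ← Complex.mul_conj', ← RCLike.star_def, star_add]
      ring
    have hstar : Integrable (fun w : Fin M → ℂ => star (∑ m, ρ m * w m)) P :=
      hX.star.integrable one_le_two
    have i1 : Integrable (fun w : Fin M → ℂ => c * star c + star c * ∑ m, ρ m * w m) P :=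
      (integrable_const _).add (hXi.const_mul _)
    have i2 : Integrable (fun w : Fin M → ℂ => c * star c + star c * ∑ m, ρ m * w m +
        c * star (∑ m, ρ m * w m)) P := i1.add (hstar.const_mul c)
    have i3 : Integrable (fun w : Fin M → ℂ =>
        (∑ m, ρ m * w m) * star (∑ m, ρ m * w m)) P := hX.integrable_mul hX.star
    simp only [h1]
    rw [integral_add i2 i3, integral_add i1 (hstar.const_mul c),
      integral_add (integrable_const _) (hXi.const_mul _), integral_const, probReal_univ, one_smul,
      integral_const_mul, integral_const_mul, hsum, hcross, hsq, RCLike.star_def,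
      Complex.mul_conj']
    push_cast
    ring
  exact_mod_cast hC

/-- The cost as bias plus variance. -/
theorem cost_eq {N M : ℕ} (i : Method) (σ : ℝ) (u : Grid N → ℂ) (Ξ : Fin M → ℝ) :
    cost i σ u Ξ = 1 / 2 * (∑ n, ‖(i.recon N Ξ *ᵥ ((vander N Ξ)ᴴ *ᵥ u) - u) n‖ ^ 2 +
      σ ^ 2 * ∑ n, ∑ m, ‖i.recon N Ξ n m‖ ^ 2) := by
  generalize hR : i.recon N Ξ = R
  set c := R *ᵥ ((vander N Ξ)ᴴ *ᵥ u) - u with hc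
  have h : ∀ w : Fin M → ℂ,
      ‖WithLp.toLp 2 (R *ᵥ ((vander N Ξ)ᴴ *ᵥ u + w) - u)‖ ^ 2 =
        ∑ n, ‖c n + ∑ m, R n m * w m‖ ^ 2 := by
    intro w
    rw [EuclideanSpace.norm_sq_eq]
    refine Finset.sum_congr rfl fun n _ => ?_
    have e : R *ᵥ ((vander N Ξ)ᴴ *ᵥ u + w) - u = c + R *ᵥ w := by
      rw [Matrix.mulVec_add, hc]; abel
    simp only [e]
    rfl
  unfold cost
  simp only [hR, h]
  rw [integral_const_mul, integral_finsetSum _ fun n _ =>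
    (integral_norm_sq_add_sum_whiteNoise σ (c n) (R n)).1]
  simp only [(integral_norm_sq_add_sum_whiteNoise σ (c _) (R _)).2, Finset.sum_add_distrib,
    ← Finset.mul_sum]

/-! ### The cost in the eigenbasis of the Gram matrix -/

section Spectral

variable {n : Type*} [Fintype n] [DecidableEq n] {G : Matrix n n ℂ}

/-- The matrix `f(G)` of a Hermitian matrix `G`, written out in Mathlib's chosen eigenbasis so that
quadratic forms and traces can be read off. -/
noncomputable def spectralMap (hG : G.IsHermitian) (f : ℝ → ℝ) : Matrix n n ℂ :=
  (hG.eigenvectorUnitary : Matrix n n ℂ) *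
    Matrix.diagonal (fun k => (f (hG.eigenvalues k) : ℂ)) *
    (hG.eigenvectorUnitary : Matrix n n ℂ)ᴴ

theorem spectralMap_congr (hG : G.IsHermitian) {f h : ℝ → ℝ}
    (hfh : ∀ k, f (hG.eigenvalues k) = h (hG.eigenvalues k)) :
    spectralMap hG f = spectralMap hG h := by
  simp only [spectralMap, hfh]

theorem spectralMap_id (hG : G.IsHermitian) : spectralMap hG (fun x => x) = G :=
  hG.eq_unitary_mul_diagonal.symm

theorem spectralMap_const (hG : G.IsHermitian) (a : ℝ) :
    spectralMap hG (fun _ => a) = (a : ℂ) • (1 : Matrix n n ℂ) := by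
  have hU : (hG.eigenvectorUnitary : Matrix n n ℂ) * (hG.eigenvectorUnitary : Matrix n n ℂ)ᴴ = 1 :=
    Unitary.coe_mul_star_self hG.eigenvectorUnitary
  rw [spectralMap, ← Matrix.smul_one_eq_diagonal, Matrix.mul_smul, Matrix.mul_one,
    Matrix.smul_mul, hU]

theorem spectralMap_add (hG : G.IsHermitian) (f h : ℝ → ℝ) :
    spectralMap hG (fun x => f x + h x) = spectralMap hG f + spectralMap hG h := by
  simp only [spectralMap, Complex.ofReal_add]
  rw [← Matrix.diagonal_add, Matrix.mul_add, Matrix.add_mul]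

theorem spectralMap_mul (hG : G.IsHermitian) (f h : ℝ → ℝ) :
    spectralMap hG (fun x => f x * h x) = spectralMap hG f * spectralMap hG h := by
  have hU : (hG.eigenvectorUnitary : Matrix n n ℂ)ᴴ * (hG.eigenvectorUnitary : Matrix n n ℂ) = 1 :=
    Unitary.coe_star_mul_self hG.eigenvectorUnitary
  simp only [spectralMap, Complex.ofReal_mul]
  rw [← Matrix.diagonal_mul_diagonal, Matrix.mul_assoc _ _
    (((hG.eigenvectorUnitary : Matrix n n ℂ)) * _ * _), Matrix.mul_assoc _ (diagonal _)
    ((hG.eigenvectorUnitary : Matrix n n ℂ)ᴴ), ← Matrix.mul_assoc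
    ((hG.eigenvectorUnitary : Matrix n n ℂ)ᴴ), hU, Matrix.one_mul]
  simp only [Matrix.mul_assoc]

theorem spectralMap_conjTranspose (hG : G.IsHermitian) (f : ℝ → ℝ) :
    (spectralMap hG f)ᴴ = spectralMap hG f := by
  simp only [spectralMap, Matrix.conjTranspose_mul, Matrix.conjTranspose_conjTranspose,
    Matrix.diagonal_conjTranspose, Matrix.mul_assoc]
  congr 3
  funext k
  simp

theorem star_dotProduct_spectralMap_mulVec (hG : G.IsHermitian) (f : ℝ → ℝ) (v : n → ℂ) :
    star v ⬝ᵥ (spectralMap hG f *ᵥ v) = ((∑ k, f (hG.eigenvalues k) *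
      ‖((hG.eigenvectorUnitary : Matrix n n ℂ)ᴴ *ᵥ v) k‖ ^ 2 : ℝ) : ℂ) := by
  rw [spectralMap, star_dotProduct_mulVec_conj, star_dotProduct_diagonal_mulVec]

theorem trace_spectralMap (hG : G.IsHermitian) (f : ℝ → ℝ) :
    (spectralMap hG f).trace = ((∑ k, f (hG.eigenvalues k) : ℝ) : ℂ) := by
  have hU : (hG.eigenvectorUnitary : Matrix n n ℂ)ᴴ * (hG.eigenvectorUnitary : Matrix n n ℂ) = 1 :=
    Unitary.coe_star_mul_self hG.eigenvectorUnitary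
  rw [spectralMap, Matrix.trace_mul_cycle, hU, Matrix.one_mul, Matrix.trace_diagonal,
    Complex.ofReal_sum]

end Spectral

theorem trace_conjTranspose_mul_self_eq {m n : Type*} [Fintype m] [Fintype n]
    (R : Matrix n m ℂ) : (Rᴴ * R).trace = ((∑ i, ∑ j, ‖R i j‖ ^ 2 : ℝ) : ℂ) := by
  rw [Finset.sum_comm]
  simp only [Matrix.trace, Matrix.diag_apply, Matrix.mul_apply, Matrix.conjTranspose_apply,
    RCLike.star_def, Complex.conj_mul']
  push_cast
  rfl

theorem vander_conjTranspose_mulVec (u : Grid N → ℂ) (Ξ : Fin M → ℝ) (m : Fin M) :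
    ((vander N Ξ)ᴴ *ᵥ u) m = uhat u (Ξ m) := by
  rw [Matrix.mulVec, dotProduct, uhat, Finset.mul_sum]
  refine Finset.sum_congr rfl fun n _ => ?_
  rw [Matrix.conjTranspose_apply, vander, Matrix.of_apply, RCLike.star_def, map_mul,
    ← Complex.exp_conj, mul_assoc, mul_comm (u n)]
  congr 2
  · simp
  · simp only [map_mul, map_div₀, map_ofNat, Complex.conj_I, Complex.conj_ofReal, map_intCast,
      map_natCast]
    ring_nf

theorem isHermitian_gram (N : ℕ) (Ξ : Fin M → ℝ) : ((vander N Ξ)ᴴ * vander N Ξ).IsHermitian :=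
  Matrix.isHermitian_conjTranspose_mul_self (vander N Ξ)

/-- When the Gram matrix `G` is invertible, each reconstruction is `A(Ξ) f(G)` with this weight `f`. -/
noncomputable def Method.weight : Method → ℝ → ℝ
  | .backProjection, _ => 1
  | .pseudoInverse, x => x⁻¹
  | .tikhonov lam _, x => (1 + lam) * (x + lam)⁻¹

theorem inv_gram_add_eq_spectralMap (Ξ : Fin M → ℝ) (lam : ℝ)
    (h : ∀ k, (isHermitian_gram N Ξ).eigenvalues k + lam ≠ 0) :
    IsUnit ((vander N Ξ)ᴴ * vander N Ξ + (lam : ℂ) • (1 : Matrix (Fin M) (Fin M) ℂ)).det ∧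
    ((vander N Ξ)ᴴ * vander N Ξ + (lam : ℂ) • (1 : Matrix (Fin M) (Fin M) ℂ))⁻¹ =
      spectralMap (isHermitian_gram N Ξ) fun x => (x + lam)⁻¹ := by
  set hG := isHermitian_gram N Ξ
  have h1 : (vander N Ξ)ᴴ * vander N Ξ + (lam : ℂ) • (1 : Matrix (Fin M) (Fin M) ℂ) =
      spectralMap hG fun x => x + lam := by
    rw [spectralMap_add hG (fun x => x) fun _ => lam, spectralMap_id, spectralMap_const]
  have h2 : spectralMap hG (fun x => x + lam) * spectralMap hG (fun x => (x + lam)⁻¹) = 1 := by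
    rw [← spectralMap_mul, spectralMap_congr hG (h := fun _ => 1) fun k => mul_inv_cancel₀ (h k),
      spectralMap_const, Complex.ofReal_one, one_smul]
  rw [h1]
  exact ⟨Matrix.isUnit_det_of_right_inverse h2, Matrix.inv_eq_right_inv h2⟩

/-- If `Bᴴ` has linearly independent columns, then `B⁺ = Bᴴ (B Bᴴ)⁻¹`. -/
theorem pinv_eq_conjTranspose_mul_inv {m n : Type*} [Fintype m] [Fintype n] [DecidableEq n]
    [DecidableEq m] (B : Matrix m n ℂ) (hB : IsUnit (B * Bᴴ).det) :
    pinv B = Bᴴ * (B * Bᴴ)⁻¹ := by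
  have h := pinv_isMoorePenrose B
  have h1 : B * pinv B = 1 := by
    have h2 : (B * pinv B) * (B * Bᴴ) = B * Bᴴ := by
      rw [← Matrix.mul_assoc, h.mul_mul_self]
    calc B * pinv B = (B * pinv B) * (B * Bᴴ) * (B * Bᴴ)⁻¹ := by
          rw [Matrix.mul_assoc, Matrix.mul_nonsing_inv _ hB, Matrix.mul_one]
      _ = 1 := by rw [h2, Matrix.mul_nonsing_inv _ hB]
  have h3 : pinv B * (B * Bᴴ) = Bᴴ := by
    rw [← Matrix.mul_assoc, ← h.hermitian_right, ← Matrix.conjTranspose_mul, ← Matrix.mul_assoc,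
      h1, Matrix.one_mul]
  calc pinv B = pinv B * (B * Bᴴ) * (B * Bᴴ)⁻¹ := by
        rw [Matrix.mul_assoc, Matrix.mul_nonsing_inv _ hB, Matrix.mul_one]
    _ = Bᴴ * (B * Bᴴ)⁻¹ := by rw [h3]

theorem recon_pseudoInverse_eq (Ξ : Fin M → ℝ) (h : IsUnit ((vander N Ξ)ᴴ * vander N Ξ).det) :
    Method.pseudoInverse.recon N Ξ = vander N Ξ * ((vander N Ξ)ᴴ * vander N Ξ)⁻¹ := by
  have := pinv_eq_conjTranspose_mul_inv (vander N Ξ)ᴴ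
    (by rwa [Matrix.conjTranspose_conjTranspose])
  rwa [Matrix.conjTranspose_conjTranspose] at this

theorem isUnit_det_mul_conjTranspose_add {m n : Type*} [Fintype m] [Fintype n] [DecidableEq n]
    (A : Matrix n m ℂ) {lam : ℝ} (hlam : 0 < lam) :
    IsUnit (A * Aᴴ + (lam : ℂ) • (1 : Matrix n n ℂ)).det := by
  open scoped ComplexOrder in
  have h1 : ((lam : ℂ) • (1 : Matrix n n ℂ)).PosDef :=
    Matrix.PosDef.one.smul (by exact_mod_cast hlam)
  open scoped ComplexOrder in
  have h2 := Matrix.PosDef.posSemidef_add (Matrix.posSemidef_self_mul_conjTranspose A) h1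
  exact (Matrix.isUnit_iff_isUnit_det _).mp h2.isUnit

/-- The push-through identity for the Tikhonov reconstruction. -/
theorem recon_tikhonov_eq (Ξ : Fin M → ℝ) (lam : ℝ) (hlam : 0 < lam)
    (h : IsUnit ((vander N Ξ)ᴴ * vander N Ξ + (lam : ℂ) • (1 : Matrix (Fin M) (Fin M) ℂ)).det) :
    (Method.tikhonov lam hlam).recon N Ξ = ((1 + lam : ℝ) : ℂ) • (vander N Ξ *
      ((vander N Ξ)ᴴ * vander N Ξ + (lam : ℂ) • (1 : Matrix (Fin M) (Fin M) ℂ))⁻¹) := by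
  set A := vander N Ξ
  have h1 := isUnit_det_mul_conjTranspose_add A hlam
  show ((1 + lam : ℝ) : ℂ) • ((A * Aᴴ + (lam : ℂ) • (1 : Matrix (Grid N) (Grid N) ℂ))⁻¹ * A) = _
  congr 1
  have h2 : A * (Aᴴ * A + (lam : ℂ) • (1 : Matrix (Fin M) (Fin M) ℂ)) =
      (A * Aᴴ + (lam : ℂ) • (1 : Matrix (Grid N) (Grid N) ℂ)) * A := by
    rw [Matrix.mul_add, Matrix.add_mul, Matrix.mul_assoc]
    simp
  calc _ = (A * Aᴴ + (lam : ℂ) • (1 : Matrix (Grid N) (Grid N) ℂ))⁻¹ *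
        (A * (Aᴴ * A + (lam : ℂ) • (1 : Matrix (Fin M) (Fin M) ℂ))) *
          (Aᴴ * A + (lam : ℂ) • (1 : Matrix (Fin M) (Fin M) ℂ))⁻¹ := by
        rw [Matrix.mul_assoc, Matrix.mul_assoc A, Matrix.mul_nonsing_inv _ h, Matrix.mul_one]
    _ = _ := by
        rw [h2, ← Matrix.mul_assoc, Matrix.nonsing_inv_mul _ h1, Matrix.one_mul]

theorem recon_eq_mul_spectralMap (i : Method) (Ξ : Fin M → ℝ)
    (h : ∀ k, 0 < (isHermitian_gram N Ξ).eigenvalues k) :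
    i.recon N Ξ = vander N Ξ * spectralMap (isHermitian_gram N Ξ) i.weight := by
  cases i with
  | backProjection =>
    have h1 := spectralMap_const (isHermitian_gram N Ξ) 1
    rw [Complex.ofReal_one, one_smul] at h1
    change vander N Ξ = vander N Ξ * spectralMap (isHermitian_gram N Ξ) (fun _ => 1)
    rw [h1, Matrix.mul_one]
  | pseudoInverse =>
    have h1 := inv_gram_add_eq_spectralMap (N := N) Ξ 0 (fun k => by
      rw [add_zero]; exact (h k).ne')
    simp only [Complex.ofReal_zero, zero_smul, add_zero] at h1
    rw [recon_pseudoInverse_eq Ξ h1.1, h1.2]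
    rfl
  | tikhonov lam hlam =>
    have h1 := inv_gram_add_eq_spectralMap (N := N) Ξ lam (fun k => by
      have := h k; positivity)
    rw [recon_tikhonov_eq Ξ lam hlam h1.1, h1.2]
    change _ = vander N Ξ * spectralMap _ (fun x => (1 + lam) * (x + lam)⁻¹)
    rw [spectralMap_mul _ (fun _ => 1 + lam), spectralMap_const, Matrix.smul_mul,
      Matrix.one_mul, Matrix.mul_smul]

/-- The cost in an eigenbasis of the Gram matrix `G`. The numbers `p k` are the squared moduli of
the coordinates of `A(Ξ)ᴴ u = (û(ξₘ))ₘ` in that basis. -/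
theorem cost_eq_spectral (i : Method) (σ : ℝ) (u : Grid N → ℂ) (Ξ : Fin M → ℝ)
    (h : ∀ k, 0 < (isHermitian_gram N Ξ).eigenvalues k) :
    ∃ p : Fin M → ℝ, (∀ k, 0 ≤ p k) ∧ ∑ k, p k = ∑ m, ‖uhat u (Ξ m)‖ ^ 2 ∧
      cost i σ u Ξ = 1 / 2 * (∑ n, ‖u n‖ ^ 2 +
        ∑ k, (i.weight ((isHermitian_gram N Ξ).eigenvalues k) ^ 2 *
          (isHermitian_gram N Ξ).eigenvalues k -
            2 * i.weight ((isHermitian_gram N Ξ).eigenvalues k)) * p k +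
        σ ^ 2 * ∑ k, i.weight ((isHermitian_gram N Ξ).eigenvalues k) ^ 2 *
          (isHermitian_gram N Ξ).eigenvalues k) := by
  rw [cost_eq, recon_eq_mul_spectralMap i Ξ h]
  set A := vander N Ξ with hA
  set hG := isHermitian_gram N Ξ
  set S := spectralMap hG i.weight with hS
  set y := Aᴴ *ᵥ u with hy
  have hSGS : (A * S)ᴴ * (A * S) = spectralMap hG fun x => i.weight x ^ 2 * x := by
    have e : (fun x => i.weight x ^ 2 * x) = fun x => i.weight x * (x * i.weight x) := by
      funext x; ring
    rw [e, spectralMap_mul, spectralMap_mul hG (fun x => x), spectralMap_id,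
      Matrix.conjTranspose_mul, hS, spectralMap_conjTranspose]
    simp only [Matrix.mul_assoc, hA]
  refine ⟨fun k => ‖((hG.eigenvectorUnitary : Matrix (Fin M) (Fin M) ℂ)ᴴ *ᵥ y) k‖ ^ 2,
    fun k => sq_nonneg _, ?_, ?_⟩
  · rw [sum_norm_sq_unitary_mulVec (Unitary.coe_mul_star_self hG.eigenvectorUnitary)]
    simp only [hy, hA, vander_conjTranspose_mulVec]
  · have hF : ∑ n, ∑ m, ‖(A * S) n m‖ ^ 2 =
        ∑ k, i.weight (hG.eigenvalues k) ^ 2 * hG.eigenvalues k := by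
      have h1 := trace_conjTranspose_mul_self_eq (A * S)
      rw [hSGS, trace_spectralMap] at h1
      exact_mod_cast h1.symm
    have hB : ∑ n, ‖((A * S) *ᵥ y - u) n‖ ^ 2 = ∑ n, ‖u n‖ ^ 2 +
        ∑ k, (i.weight (hG.eigenvalues k) ^ 2 * hG.eigenvalues k -
          2 * i.weight (hG.eigenvalues k)) *
          ‖((hG.eigenvectorUnitary : Matrix (Fin M) (Fin M) ℂ)ᴴ *ᵥ y) k‖ ^ 2 := by
      have h1 : star ((A * S) *ᵥ y) ⬝ᵥ ((A * S) *ᵥ y) =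
          star y ⬝ᵥ (spectralMap hG (fun x => i.weight x ^ 2 * x) *ᵥ y) := by
        rw [Matrix.star_mulVec, ← Matrix.dotProduct_mulVec, Matrix.mulVec_mulVec, hSGS]
      have h2 : star u ⬝ᵥ ((A * S) *ᵥ y) = star y ⬝ᵥ (S *ᵥ y) := by
        rw [← Matrix.mulVec_mulVec, Matrix.dotProduct_mulVec, hy, Matrix.star_mulVec,
          Matrix.conjTranspose_conjTranspose]
      have h3 : star ((A * S) *ᵥ y) ⬝ᵥ u = star y ⬝ᵥ (S *ᵥ y) := by
        rw [Matrix.star_mulVec, Matrix.conjTranspose_mul, hS, spectralMap_conjTranspose,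
          ← Matrix.dotProduct_mulVec, ← Matrix.mulVec_mulVec, ← hy]
      have h4 := star_dotProduct_self_eq ((A * S) *ᵥ y - u)
      rw [star_sub, sub_dotProduct, dotProduct_sub, dotProduct_sub, h1, h2, h3, hS,
        star_dotProduct_spectralMap_mulVec, star_dotProduct_spectralMap_mulVec,
        star_dotProduct_self_eq] at h4
      simp only [sub_mul, Finset.sum_sub_distrib, mul_assoc (2 : ℝ), ← Finset.mul_sum]
      rw [← Complex.ofReal_sub, ← Complex.ofReal_sub, ← Complex.ofReal_sub] at h4
      have h5 := Complex.ofReal_injective h4.symm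
      rw [h5]
      ring
    rw [hB, hF]

/-- The bias and variance weights of each method, compared with their values `-1` and `1` for
orthonormal columns. -/
theorem abs_weight_sub_le (i : Method) {ε x : ℝ} (h0 : 0 < ε) (h1 : ε < 1) (hx : |x - 1| ≤ ε) :
    |i.weight x ^ 2 * x - 2 * i.weight x + 1| ≤ i.bConst ε ∧
      |i.weight x ^ 2 * x - 1| ≤ i.bConst ε := by
  have hxl : 1 - ε ≤ x := by linarith [(abs_le.mp hx).1]
  have hx0 : 0 < x := by linarith
  have he : 0 < 1 - ε := by linarith
  cases i with
  | backProjection =>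
    simp only [Method.weight, Method.bConst]
    constructor
    · rwa [show (1 : ℝ) ^ 2 * x - 2 * 1 + 1 = x - 1 by ring]
    · rwa [show (1 : ℝ) ^ 2 * x - 1 = x - 1 by ring]
  | pseudoInverse =>
    simp only [Method.weight, Method.bConst]
    have h2 : |x⁻¹ - 1| ≤ ε / (1 - ε) := by
      rw [show x⁻¹ - 1 = -(x - 1) / x by field_simp; ring, abs_div, abs_neg, abs_of_pos hx0]
      exact div_le_div₀ h0.le hx he hxl
    constructor
    · rwa [show x⁻¹ ^ 2 * x - 2 * x⁻¹ + 1 = -(x⁻¹ - 1) by field_simp; ring, abs_neg]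
    · rwa [show x⁻¹ ^ 2 * x - 1 = x⁻¹ - 1 by field_simp]
  | tikhonov lam hlam =>
    simp only [Method.weight, Method.bConst]
    set t := (1 + lam) * (x + lam)⁻¹ with ht
    have hxl0 : 0 < x + lam := by linarith
    have ht0 : 0 < t := by positivity
    have ht1 : t ≤ 1 / (1 - ε) := by
      rw [ht, ← div_eq_mul_inv, div_le_div_iff₀ hxl0 he]
      nlinarith
    have ht2 : |t - 1| ≤ ε / (1 - ε) := by
      rw [show t - 1 = -(x - 1) / (x + lam) by rw [ht]; field_simp; ring, abs_div, abs_neg,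
        abs_of_pos hxl0]
      exact div_le_div₀ h0.le hx he (by linarith)
    have ht3 : t ^ 2 ≤ 1 / (1 - ε) ^ 2 := by
      rw [← _root_.one_div_pow]; exact pow_le_pow_left₀ ht0.le ht1 2
    have ht4 : |t ^ 2 * (x - 1)| ≤ ε / (1 - ε) ^ 2 := by
      rw [abs_mul, abs_of_nonneg (sq_nonneg t)]
      calc t ^ 2 * |x - 1| ≤ 1 / (1 - ε) ^ 2 * ε := by gcongr
        _ = _ := by ring
    constructor
    · rw [show t ^ 2 * x - 2 * t + 1 = (t - 1) ^ 2 + t ^ 2 * (x - 1) by ring]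
      have h3 : |(t - 1) ^ 2| ≤ ε / (1 - ε) ^ 2 := by
        rw [abs_pow]
        calc |t - 1| ^ 2 ≤ (ε / (1 - ε)) ^ 2 := by gcongr
          _ = ε ^ 2 / (1 - ε) ^ 2 := by rw [div_pow]
          _ ≤ _ := by gcongr; nlinarith
      calc _ ≤ ε / (1 - ε) ^ 2 + ε / (1 - ε) ^ 2 := (abs_add_le _ _).trans (add_le_add h3 ht4)
        _ = 2 * ε / (1 - ε) ^ 2 := by ring
        _ ≤ _ := by gcongr; norm_num
    · rw [show t ^ 2 * x - 1 = (t - 1) * (t + 1) + t ^ 2 * (x - 1) by ring]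
      have h3 : |(t - 1) * (t + 1)| ≤ 2 * ε / (1 - ε) ^ 2 := by
        rw [abs_mul, abs_of_pos (by linarith : 0 < t + 1)]
        have h4 : t + 1 ≤ 2 / (1 - ε) := by
          have : 1 ≤ 1 / (1 - ε) := by rw [one_le_div he]; linarith
          calc t + 1 ≤ 1 / (1 - ε) + 1 / (1 - ε) := add_le_add ht1 this
            _ = _ := by ring
        calc |t - 1| * (t + 1) ≤ ε / (1 - ε) * (2 / (1 - ε)) := by gcongr
          _ = _ := by rw [div_mul_div_comm]; ring
      calc _ ≤ 2 * ε / (1 - ε) ^ 2 + ε / (1 - ε) ^ 2 :=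
            (abs_add_le _ _).trans (add_le_add h3 ht4)
        _ = 3 * ε / (1 - ε) ^ 2 := by ring
        _ ≤ _ := by gcongr; norm_num

/-- Up to the error `b`, the cost is the separable function `-½ ∑ |û(ξ_m)|²` plus a constant. -/
theorem abs_cost_sub_le (hN : Even N) (hN0 : 0 < N) (i : Method) (σ : ℝ) (u : Grid N → ℂ)
    (Ξ : Fin M → ℝ) {D : ℝ} (hD : 1 < D)
    (hsep : ∀ r s, r ≠ s → ∀ k : ℤ, D ≤ |Ξ r - Ξ s - k * N|) :
    |cost i σ u Ξ - 1 / 2 * (∑ n, ‖u n‖ ^ 2 + M * σ ^ 2 - ∑ m, ‖uhat u (Ξ m)‖ ^ 2)| ≤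
      1 / 2 * (i.bConst (1 / D) * (∑ m, ‖uhat u (Ξ m)‖ ^ 2 + M * σ ^ 2)) := by
  have hD0 : 0 < D := by linarith
  have hg := abs_gram_eigenvalue_sub_one_le hN hN0 Ξ hD0 hsep
  have he0 : 0 < 1 / D := by positivity
  have he1 : 1 / D < 1 := by rw [div_lt_one hD0]; exact hD
  obtain ⟨p, hp0, hp, hcost⟩ := cost_eq_spectral i σ u Ξ fun k => by
    have := (abs_le.mp (hg k)).1
    linarith
  set hG := isHermitian_gram N Ξ
  set b := i.bConst (1 / D)
  have hw := fun k => abs_weight_sub_le i he0 he1 (hg k)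
  rw [hcost, ← hp]
  set biasWeight : Fin M → ℝ := fun k => i.weight (hG.eigenvalues k) ^ 2 * hG.eigenvalues k -
    2 * i.weight (hG.eigenvalues k)
  set varWeight : Fin M → ℝ := fun k => i.weight (hG.eigenvalues k) ^ 2 * hG.eigenvalues k
  have e : 1 / 2 * (∑ n, ‖u n‖ ^ 2 + ∑ k, biasWeight k * p k + σ ^ 2 * ∑ k, varWeight k) -
      1 / 2 * (∑ n, ‖u n‖ ^ 2 + M * σ ^ 2 - ∑ k, p k) =
      1 / 2 * (∑ k, ((biasWeight k + 1) * p k + σ ^ 2 * (varWeight k - 1))) := by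
    simp only [Finset.sum_add_distrib, add_mul, one_mul, ← Finset.mul_sum,
      Finset.sum_sub_distrib, Finset.sum_const, Finset.card_univ, Fintype.card_fin, nsmul_eq_mul,
      mul_one]
    ring
  rw [e, abs_mul, abs_of_pos (by norm_num : (0 : ℝ) < 1 / 2)]
  refine mul_le_mul_of_nonneg_left ?_ (by norm_num)
  calc |∑ k, ((biasWeight k + 1) * p k + σ ^ 2 * (varWeight k - 1))| ≤
        ∑ k, (b * p k + b * σ ^ 2) := by
        refine (Finset.abs_sum_le_sum_abs _ _).trans (Finset.sum_le_sum fun k _ => ?_)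
        refine (abs_add_le _ _).trans (add_le_add ?_ ?_)
        · rw [abs_mul, abs_of_nonneg (hp0 k)]
          exact mul_le_mul_of_nonneg_right (hw k).1 (hp0 k)
        · rw [abs_mul, abs_of_nonneg (sq_nonneg σ), mul_comm]
          exact mul_le_mul_of_nonneg_right (hw k).2 (sq_nonneg σ)
    _ = b * (∑ k, p k + M * σ ^ 2) := by
        simp only [Finset.sum_add_distrib, ← Finset.mul_sum, Finset.sum_const, Finset.card_univ,
          Fintype.card_fin, nsmul_eq_mul]
        ring

/-! ### Continuity and periodicity of the cost -/

theorem continuous_vander (N M : ℕ) : Continuous fun Ξ : Fin M → ℝ => vander N Ξ := by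
  refine continuous_matrix fun n m => ?_
  simp only [vander, Matrix.of_apply]
  fun_prop

theorem continuous_matrix_inv_of_isUnit {X n : Type*} [TopologicalSpace X] [Fintype n]
    [DecidableEq n] {F : X → Matrix n n ℂ} (hF : Continuous F) (h : ∀ x, IsUnit (F x).det) :
    Continuous fun x => (F x)⁻¹ := by
  refine continuous_iff_continuousAt.mpr fun x => ?_
  refine ContinuousAt.comp (g := fun B : Matrix n n ℂ => B⁻¹)
    (continuousAt_matrix_inv (F x) ?_) hF.continuousAt
  rw [Ring.inverse_eq_inv']
  exact continuousAt_inv₀ (h x).ne_zero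

theorem continuousOn_cost (i : Method) (σ : ℝ) (u : Grid N → ℂ) {S : Set (Fin M → ℝ)}
    (hS : ∀ Ξ ∈ S, ∀ k, 0 < (isHermitian_gram N Ξ).eigenvalues k) :
    ContinuousOn (fun Ξ : Fin M → ℝ => cost i σ u Ξ) S := by
  rw [continuousOn_iff_continuous_domRestrict]
  have hA : Continuous fun Ξ : S => vander N (Ξ : Fin M → ℝ) :=
    (continuous_vander N M).comp continuous_subtype_val
  have hR : Continuous fun Ξ : S => i.recon N (Ξ : Fin M → ℝ) := by
    cases i with
    | backProjection => exact hA
    | pseudoInverse =>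
      have hu : ∀ Ξ : S, IsUnit ((vander N Ξ.1)ᴴ * vander N Ξ.1).det := fun Ξ => by
        have h := (inv_gram_add_eq_spectralMap (N := N) Ξ.1 0 fun k => by
          rw [add_zero]; exact (hS Ξ.1 Ξ.2 k).ne').1
        simpa using h
      simp only [fun Ξ : S => recon_pseudoInverse_eq Ξ.1 (hu Ξ)]
      exact hA.matrix_mul
        (continuous_matrix_inv_of_isUnit (hA.matrix_conjTranspose.matrix_mul hA) hu)
    | tikhonov lam hlam =>
      have hG : Continuous fun Ξ : S => vander N Ξ.1 * (vander N Ξ.1)ᴴ +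
          ((lam : ℝ) : ℂ) • (1 : Matrix (Grid N) (Grid N) ℂ) :=
        (hA.matrix_mul hA.matrix_conjTranspose).add continuous_const
      have hI := (continuous_matrix_inv_of_isUnit hG fun Ξ =>
        isUnit_det_mul_conjTranspose_add (vander N Ξ.1) hlam).matrix_mul hA
      exact hI.const_smul ((1 + lam : ℝ) : ℂ)
  have hv : Continuous fun Ξ : S =>
      i.recon N Ξ.1 *ᵥ ((vander N Ξ.1)ᴴ *ᵥ u) - u :=
    (hR.matrix_mulVec (hA.matrix_conjTranspose.matrix_mulVec continuous_const)).sub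
      continuous_const
  change Continuous fun Ξ : S => cost i σ u Ξ.1
  simp only [cost_eq]
  refine continuous_const.mul (Continuous.add ?_ (continuous_const.mul ?_))
  · exact continuous_finsetSum _ fun n _ => ((continuous_apply n).comp hv).norm.pow 2
  · exact continuous_finsetSum _ fun n _ => continuous_finsetSum _ fun m _ =>
      (hR.matrix_elem n m).norm.pow 2

theorem vander_add_int_mul (hN0 : 0 < N) (Ξ : Fin M → ℝ) (k : Fin M → ℤ) :
    vander N (fun m => Ξ m + k m * N) = vander N Ξ := by
  have hN : (N : ℂ) ≠ 0 := by exact_mod_cast hN0.ne'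
  ext n m
  simp only [vander, Matrix.of_apply]
  congr 1
  refine Complex.exp_eq_exp_iff_exists_int.mpr ⟨k m * n.1, ?_⟩
  push_cast
  field_simp

theorem cost_congr (i : Method) (σ : ℝ) (u : Grid N → ℂ) {Ξ Ξ' : Fin M → ℝ}
    (h : vander N Ξ = vander N Ξ') : cost i σ u Ξ = cost i σ u Ξ' := by
  have hR : i.recon N Ξ = i.recon N Ξ' := by cases i <;> simp only [Method.recon, h]
  simp only [cost, hR, h]

theorem isLocalMin_cost_add_int_mul (hN0 : 0 < N) (i : Method) (σ : ℝ) (u : Grid N → ℂ)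
    {Ξ : Fin M → ℝ} (k : Fin M → ℤ)
    (h : IsLocalMin (fun X : Fin M → ℝ => cost i σ u X) Ξ) :
    IsLocalMin (fun X : Fin M → ℝ => cost i σ u X) (fun m => Ξ m + k m * N) := by
  have hper : (fun X : Fin M → ℝ => cost i σ u X) =
      (fun X : Fin M → ℝ => cost i σ u X) ∘ fun X m => X m + ((-k) m : ℤ) * N := by
    funext X
    exact cost_congr i σ u (vander_add_int_mul hN0 X (-k)).symm
  rw [hper]
  refine IsLocalMin.comp_continuous ?_
    (continuous_pi fun m => (continuous_apply m).add continuous_const).continuousAt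
  simpa using h

/-! ### Local minimizers -/

theorem torusDist_le (N : ℕ) (x y : ℝ) (k : ℤ) : torusDist N x y ≤ |x - y - k * N| :=
  ciInf_le ⟨0, by rintro _ ⟨j, rfl⟩; exact abs_nonneg _⟩ k

theorem aConst_nonneg (i : Method) {ε : ℝ} (h0 : 0 < ε) (h1 : ε < 1) : 0 ≤ i.aConst ε := by
  have : 0 < 1 - ε := by linarith
  cases i <;> simp only [Method.aConst] <;> positivity

theorem bConst_nonneg (i : Method) {ε : ℝ} (h0 : 0 < ε) (h1 : ε < 1) : 0 ≤ i.bConst ε := by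
  have : 0 < 1 - ε := by linarith
  cases i <;> simp only [Method.bConst] <;> positivity

/-- The cost is continuous on the closed box, so it has a minimizer there; on the boundary of the
box it exceeds its value at the centre. -/
theorem exists_isLocalMin_cost_of_box (hN : Even N) (hN0 : 0 < N) (σ : ℝ) (u : Grid N → ℂ)
    (i : Method) {δ r c : ℝ} (hr : 0 < r) (hδ : 1 + 2 * r < δ) (hc : 0 < c) (τ : Fin M → ℝ)
    (hsep : ∀ m k, m ≠ k → δ ≤ torusDist N (τ m) (τ k))
    (hconc : ∀ m, ∀ h ∈ Set.Icc (-r) r, ‖uhat u (τ m + h)‖ ^ 2 ≤ ‖uhat u (τ m)‖ ^ 2 - c * h ^ 2)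
    (hcond : (i.bConst (1 / (δ - 2 * r)) + 2 * i.aConst (1 / (δ - 2 * r))) *
        ∑ m, ‖uhat u (τ m)‖ ^ 2 + i.bConst (1 / (δ - 2 * r)) * (M : ℝ) * σ ^ 2 < c * r ^ 2 / 2) :
    ∃ Ξ : Fin M → ℝ, (∀ m, |Ξ m - τ m| < r) ∧
      IsLocalMin (fun X : Fin M → ℝ => cost i σ u X) Ξ := by
  have hD : 1 < δ - 2 * r := by linarith
  have hD0 : 0 < δ - 2 * r := by linarith
  have he0 : 0 < 1 / (δ - 2 * r) := by positivity
  have he1 : 1 / (δ - 2 * r) < 1 := by rwa [div_lt_one hD0]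
  have hbox : ∀ Ξ ∈ Metric.closedBall τ r, ∀ m, |Ξ m - τ m| ≤ r := by
    intro Ξ hΞ m
    rw [← Real.dist_eq]
    exact (dist_le_pi_dist Ξ τ m).trans (Metric.mem_closedBall.mp hΞ)
  have hsepbox : ∀ Ξ ∈ Metric.closedBall τ r, ∀ m k, m ≠ k → ∀ j : ℤ,
      δ - 2 * r ≤ |Ξ m - Ξ k - j * N| := by
    intro Ξ hΞ m k hmk j
    have h1 := (hsep m k hmk).trans (torusDist_le N (τ m) (τ k) j)
    have h2 := hbox Ξ hΞ m
    have h3 := hbox Ξ hΞ k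
    have h4 : |τ m - τ k - j * N| ≤ |Ξ m - Ξ k - j * N| + |Ξ m - τ m| + |Ξ k - τ k| := by
      rw [show τ m - τ k - j * N = (Ξ m - Ξ k - j * N) - (Ξ m - τ m) + (Ξ k - τ k) by ring]
      exact (abs_add_le _ _).trans (add_le_add_left (abs_sub _ _) _)
    linarith
  have hcont : ContinuousOn (fun Ξ : Fin M → ℝ => cost i σ u Ξ) (Metric.closedBall τ r) := by
    refine continuousOn_cost i σ u fun Ξ hΞ k => ?_
    have := (abs_le.mp (abs_gram_eigenvalue_sub_one_le hN hN0 Ξ hD0 (hsepbox Ξ hΞ) k)).1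
    linarith
  have hτ : τ ∈ Metric.closedBall τ r := Metric.mem_closedBall_self hr.le
  obtain ⟨Ξ, hΞ, hmin⟩ := (isCompact_closedBall τ r).exists_isMinOn ⟨τ, hτ⟩ hcont
  have hlt : ∀ m, |Ξ m - τ m| < r := by
    by_contra! hcon
    obtain ⟨m₀, hm₀⟩ := hcon
    have hm₀' : |Ξ m₀ - τ m₀| = r := le_antisymm (hbox Ξ hΞ m₀) hm₀
    have hterm : ∀ m, c * (Ξ m - τ m) ^ 2 ≤ ‖uhat u (τ m)‖ ^ 2 - ‖uhat u (Ξ m)‖ ^ 2 := by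
      intro m
      have := hconc m (Ξ m - τ m) (abs_le.mp (hbox Ξ hΞ m))
      rw [add_sub_cancel] at this
      linarith
    have hdrop : c * r ^ 2 ≤ ∑ m, ‖uhat u (τ m)‖ ^ 2 - ∑ m, ‖uhat u (Ξ m)‖ ^ 2 := by
      rw [← Finset.sum_sub_distrib]
      calc c * r ^ 2 = c * (Ξ m₀ - τ m₀) ^ 2 := by rw [← hm₀', sq_abs]
        _ ≤ ∑ m, c * (Ξ m - τ m) ^ 2 :=
            Finset.single_le_sum (f := fun m => c * (Ξ m - τ m) ^ 2)
              (fun m _ => by positivity) (Finset.mem_univ m₀)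
        _ ≤ _ := Finset.sum_le_sum fun m _ => hterm m
    have h1 := (abs_le.mp (abs_cost_sub_le hN hN0 i σ u Ξ hD (hsepbox Ξ hΞ))).1
    have h2 := (abs_le.mp (abs_cost_sub_le hN hN0 i σ u τ hD (hsepbox τ hτ))).2
    have h3 : cost i σ u Ξ ≤ cost i σ u τ := hmin hτ
    have hb := bConst_nonneg i he0 he1
    have ha := aConst_nonneg i he0 he1
    set P := ∑ m, ‖uhat u (Ξ m)‖ ^ 2
    set Q := ∑ m, ‖uhat u (τ m)‖ ^ 2
    have hQ : 0 ≤ Q := Finset.sum_nonneg fun m _ => sq_nonneg _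
    have hPQ : P ≤ Q := by
      have : 0 ≤ c * r ^ 2 := by positivity
      linarith
    -- Minimality gives `(Q - P) / 2 ≤ b (P + Q + 2 M σ²) / 2 ≤ b (Q + M σ²)`, against `hdrop`.
    nlinarith [mul_nonneg ha hQ, mul_le_mul_of_nonneg_left hPQ hb]
  refine ⟨Ξ, hlt, hmin.isLocalMin ?_⟩
  refine Filter.mem_of_superset (Metric.isOpen_ball.mem_nhds ?_) Metric.ball_subset_closedBall
  exact (dist_pi_lt_iff hr).mpr fun m => by rw [Real.dist_eq]; exact hlt m

/-- The coordinatewise representative modulo `N` in `[-N/2, N/2)`. -/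
noncomputable def reduceMod (hN0 : 0 < N) (Ξ : Fin M → ℝ) (m : Fin M) : ℝ :=
  toIcoMod (show (0 : ℝ) < N by exact_mod_cast hN0) (-((N : ℝ) / 2)) (Ξ m)

theorem exists_reduceMod_eq (hN0 : 0 < N) (Ξ : Fin M → ℝ) :
    ∃ k : Fin M → ℤ, reduceMod hN0 Ξ = fun m => Ξ m + k m * N := by
  refine ⟨fun m => -toIcoDiv (show (0 : ℝ) < N by exact_mod_cast hN0) (-((N : ℝ) / 2)) (Ξ m), ?_⟩
  funext m
  rw [reduceMod, toIcoMod, zsmul_eq_mul]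
  push_cast
  ring

theorem reduceMod_mem_Ico (hN0 : 0 < N) (Ξ : Fin M → ℝ) (m : Fin M) :
    reduceMod hN0 Ξ m ∈ Set.Ico (-((N : ℝ) / 2)) ((N : ℝ) / 2) := by
  have h := toIcoMod_mem_Ico (show (0 : ℝ) < N by exact_mod_cast hN0) (-((N : ℝ) / 2)) (Ξ m)
  rwa [show -((N : ℝ) / 2) + N = N / 2 by ring] at h

/-- Boxes of radius `r` around separated centres are disjoint modulo `N`. -/
theorem eq_of_reduceMod_eq (hN0 : 0 < N) {δ r : ℝ} (hδ : 2 * r < δ) {Ξ Ξ' τ τ' : Fin M → ℝ}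
    (hΞ : ∀ m, |Ξ m - τ m| < r) (hΞ' : ∀ m, |Ξ' m - τ' m| < r)
    (hsep : ∀ m, τ m ≠ τ' m → δ ≤ torusDist N (τ m) (τ' m))
    (h : reduceMod hN0 Ξ = reduceMod hN0 Ξ') : τ = τ' := by
  obtain ⟨k, hk⟩ := exists_reduceMod_eq hN0 Ξ
  obtain ⟨k', hk'⟩ := exists_reduceMod_eq hN0 Ξ'
  funext m
  by_contra hne
  have h1 := (hsep m hne).trans (torusDist_le N (τ m) (τ' m) (k' m - k m))
  have h2 : Ξ m + k m * N = Ξ' m + k' m * N := by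
    have := congrFun h m
    rwa [hk, hk'] at this
  have h3 : τ m - τ' m - ((k' m - k m : ℤ) : ℝ) * N = -(Ξ m - τ m) + (Ξ' m - τ' m) := by
    push_cast
    linear_combination h2
  have h4 := abs_add_le (-(Ξ m - τ m)) (Ξ' m - τ' m)
  rw [abs_neg] at h4
  rw [h3] at h1
  linarith [hΞ m, hΞ' m]

theorem card_embedding_le_encard {α : Type*} {M : ℕ} (Z : Finset ℝ) (S : Set α)
    (F : (Fin M ↪ Z) → α) (hF : Function.Injective F) (hS : ∀ e, F e ∈ S) :
    ((Z.card.choose M * M.factorial : ℕ) : ℕ∞) ≤ S.encard := by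
  have h1 : ((Z.card.choose M * M.factorial : ℕ) : ℕ∞) = (F '' Set.univ).encard := by
    rw [hF.encard_image, Set.encard_univ, ENat.card_eq_coe_fintype_card,
      Fintype.card_embedding_eq, Fintype.card_fin, Fintype.card_coe,
      Nat.descFactorial_eq_factorial_mul_choose, mul_comm]
  rw [h1]
  exact Set.encard_le_encard (by rintro _ ⟨e, -, rfl⟩; exact hS e)

end FourierSampling

theorem theorem1 (N M : ℕ) (hN : Even N) (hN0 : 0 < N) (σ : ℝ) (hσ : 0 ≤ σ)
    (u : FourierSampling.Grid N → ℂ) (i : FourierSampling.Method)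
    (Z : Finset ℝ) (hM : M ≤ Z.card) (δ r c : ℝ) (hr : 0 < r) (hδ : 1 + 2 * r < δ) (hc : 0 < c)
    (hmax : ∀ ζ ∈ Z, IsLocalMax (fun ξ : ℝ => ‖FourierSampling.uhat u ξ‖ ^ 2) ζ)
    (hsep : ∀ ζ ∈ Z, ∀ ζ' ∈ Z, ζ ≠ ζ' → δ ≤ FourierSampling.torusDist N ζ ζ')
    (hconc : ∀ ζ ∈ Z, ∀ h ∈ Set.Icc (-r) r,
      ‖FourierSampling.uhat u (ζ + h)‖ ^ 2 ≤ ‖FourierSampling.uhat u ζ‖ ^ 2 - c * h ^ 2)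
    (hcond : ∀ S : Finset ℝ, S ⊆ Z → S.card = M →
      (i.bConst (1 / (δ - 2 * r)) + 2 * i.aConst (1 / (δ - 2 * r))) *
            ∑ ζ ∈ S, ‖FourierSampling.uhat u ζ‖ ^ 2 +
          i.bConst (1 / (δ - 2 * r)) * (M : ℝ) * σ ^ 2 < c * r ^ 2 / 2) :
    (∀ τ : Fin M → ℝ, Function.Injective τ → (∀ m, τ m ∈ Z) →
      ∃ Ξ : Fin M → ℝ, (∀ m, |Ξ m - τ m| < r) ∧
        IsLocalMin (fun X : Fin M → ℝ => FourierSampling.cost i σ u X) Ξ) ∧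
    ((Z.card.choose M * M.factorial : ℕ) : ℕ∞) ≤
      Set.encard {Ξ : Fin M → ℝ | (∀ m, Ξ m ∈ Set.Ico (-((N : ℝ) / 2)) ((N : ℝ) / 2)) ∧
        IsLocalMin (fun X : Fin M → ℝ => FourierSampling.cost i σ u X) Ξ} := by
  open FourierSampling in
  have hbox : ∀ τ : Fin M → ℝ, Function.Injective τ → (∀ m, τ m ∈ Z) →
      ∃ Ξ : Fin M → ℝ, (∀ m, |Ξ m - τ m| < r) ∧
        IsLocalMin (fun X : Fin M → ℝ => cost i σ u X) Ξ := by
    intro τ hτ hτZ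
    refine exists_isLocalMin_cost_of_box hN hN0 σ u i hr hδ hc τ
      (fun m k hmk => hsep _ (hτZ m) _ (hτZ k) (hτ.ne hmk)) (fun m => hconc _ (hτZ m)) ?_
    have h := hcond (Finset.univ.image τ)
      (Finset.image_subset_iff.mpr fun m _ => hτZ m)
      (by rw [Finset.card_image_of_injective _ hτ, Finset.card_univ, Fintype.card_fin])
    rwa [Finset.sum_image hτ.injOn] at h
  refine ⟨hbox, ?_⟩
  have hemb : ∀ e : Fin M ↪ Z, Function.Injective fun m => (e m : ℝ) :=
    fun e => Subtype.val_injective.comp e.injective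
  choose Ξ hΞ hmin using fun e : Fin M ↪ Z =>
    hbox (fun m => (e m : ℝ)) (hemb e) fun m => (e m).2
  refine FourierSampling.card_embedding_le_encard Z _
    (fun e => FourierSampling.reduceMod hN0 (Ξ e)) ?_ fun e => ⟨?_, ?_⟩
  · intro e e' hee
    have h := FourierSampling.eq_of_reduceMod_eq hN0 (by linarith : 2 * r < δ) (hΞ e) (hΞ e')
      (fun m hne => hsep _ (e m).2 _ (e' m).2 hne) hee
    ext m
    exact congrFun h m
  · exact FourierSampling.reduceMod_mem_Ico hN0 (Ξ e)
  · obtain ⟨k, hk⟩ := FourierSampling.exists_reduceMod_eq hN0 (Ξ e)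
    rw [hk]
    exact FourierSampling.isLocalMin_cost_add_int_mul hN0 i σ u k (hmin e)
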